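/- Let $a<b$, let $m\ge 1$ be an integer and let $k\in L^2((a,b)^2)$ be a real kernel such that the integral operator $K:L^2(a,b)\to L^2(a,b)$, $(Kx)(s)=\int_a^b k(s,t)\,x(t)\,dt$, satisfies $R(K)\subset H^m(a,b)$. For $u\in H^m(a,b)$ and $s\in[a,b]$, $u(s)$ is the value of the continuous representative of $u$ on $[a,b]$. Norms without subscript are those of $L^2(a,b)$. *Data.* Let $n\ge1$ and let $a\le s_1<\dots<s_n\le b$ be sampling points with $h=\max_{s\in[a,b]}\min_i|s-s_i|\le B\,\min_{i\ne j}|s_i-s_j|$ (the last condition being void for $n=1$). Let $y\in R(K)$, let $x^\dagger$ be the best-approximate solution of $Kx=y$ (the least-squares solution of minimal norm), and let $w_i=y(s_i)+e_i$, where $e_1,\dots,e_n$ are independent square-integrable random variables with $\mathbb E[e_i]=0$ and $\operatorname{Var}[e_i]\le\sigma^2$. Let $x_{n,\alpha}$ be the minimizer over $x\in L^2(a,b)$ of $\frac1n\sum_{i=1}^n\bigl((Kx)(s_i)-w_i\bigr)^2+\alpha\|x\|^2$. *Spaces.* Let $(s_j;\phi_j,\psi_j)_j$ be a singular system of $K$: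 $s_j>0$, $(\phi_j)$ and $(\psi_j)$ orthonormal, $K\phi_j=s_j\psi_j$, $K^*\psi_j=s_j\phi_j$, and $(\phi_j)$ complete in $N(K)^\perp$ (here $s_j$ denotes singular values, not sampling points). Let $W=\{f\in N(K)^\perp:\sum_j f_j^2/s_j<\infty\}$, $f_j=(f,\phi_j)$, with $\|f\|_W^2=\sum_j f_j^2/s_j$, and let $\|u\|_{W^*}=\sup_{0\ne v\in W}|(u,v)|/\|v\|_W$. **Theorem.** The operator $K$ has a singular system; for every $\alpha\ge h^{2m}$ and all data $w\in\mathbb R^n$ the minimizer exists and is unique; and $\|u\|_{W^*}^2=\sum_j s_j\,(u,\phi_j)^2$ for every $u\in N(K)^\perp$. There is a constant $C>0$, depending only on $a,b,m,k$ and $B$ (not on $n$, the sampling points, $h$, $\alpha$, $\sigma$, the noise, $y$ or $x^\dagger$), such that for every $\alpha\ge h^{2m}$ one has $x_{n,\alpha}-x^\dagger\in N(K)^\perp$, the random variable $\|x_{n,\alpha}-x^\dagger\|_{W^*}^2$ is integrable, and $$\mathbb E\bigl[\|x_{n,\alpha}-x^\dagger\|_{W^*}^2\bigr]\le C\,\alpha^{1/2}\,\|x^\dagger\|^2+\frac{C\sigma^2}{n\,\alpha^{\frac12+\frac1{2m}}}.$$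 Consequently, for fixed $B$, $\sigma$ and $y$, along any sequence of such data sets and parameters $\alpha\ge h^{2m}$ with $\alpha\to0$ and $n\,\alpha^{\frac12+\frac1{2m}}\to\infty$, one has $\mathbb E\bigl[\|x_{n,\alpha}-x^\dagger\|_{W^*}^2\bigr]\to0$. -/

import Mathlib

open MeasureTheory ProbabilityTheory Filter Topology Set

noncomputable section

namespace WeakTikhonov

/-- Lebesgue measure on the interval `(a, b)`. -/
abbrev intervalMeasure (a b : ℝ) : Measure ℝ := volume.restrict (Ioo a b)

/-- The real Hilbert space `L²(a, b)`. -/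
abbrev L2 (a b : ℝ) : Type := Lp ℝ 2 (intervalMeasure a b)

/-- `k ∈ L²((a, b)²)`. -/
abbrev SquareIntegrableKernel (a b : ℝ) (k : ℝ → ℝ → ℝ) : Prop :=
  MemLp (fun p : ℝ × ℝ => k p.1 p.2) 2 ((intervalMeasure a b).prod (intervalMeasure a b))

section IntegralOperator

variable {a b : ℝ} {k : ℝ → ℝ → ℝ}

theorem SquareIntegrableKernel.section_memLp (hk : SquareIntegrableKernel a b k) :
    ∀ᵐ s ∂(intervalMeasure a b), MemLp (k s) 2 (intervalMeasure a b) := by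
  filter_upwards [hk.1.prodMk_left, hk.integrable_sq.prod_right_ae] with s h1 h2
  exact (memLp_two_iff_integrable_sq h1).2 h2

theorem SquareIntegrableKernel.sq_integral_le (hk : SquareIntegrableKernel a b k) (x : L2 a b) :
    ∀ᵐ s ∂(intervalMeasure a b),
      (∫ t in Ioo a b, k s t * x t) ^ 2 ≤ (∫ t in Ioo a b, k s t ^ 2) * ‖x‖ ^ 2 := by
  filter_upwards [hk.section_memLp] with s hs
  have h1 : ∫ t in Ioo a b, k s t * x t = inner ℝ x (hs.toLp (k s)) := by
    rw [L2.inner_def]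
    refine integral_congr_ae ?_
    filter_upwards [hs.coeFn_toLp] with t ht
    simp [ht]
  have h2 : ∫ t in Ioo a b, k s t ^ 2 = ‖hs.toLp (k s)‖ ^ 2 := by
    rw [← real_inner_self_eq_norm_sq, L2.inner_def]
    refine integral_congr_ae ?_
    filter_upwards [hs.coeFn_toLp] with t ht
    simp [ht, sq]
  rw [h1, h2, ← mul_pow, mul_comm]
  exact sq_le_sq' (neg_le_of_abs_le (abs_real_inner_le_norm _ _)) (real_inner_le_norm _ _)

theorem SquareIntegrableKernel.integral_memLp (hk : SquareIntegrableKernel a b k) (x : L2 a b) :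
    MemLp (fun s => ∫ t in Ioo a b, k s t * x t) 2 (intervalMeasure a b) := by
  have hm : AEStronglyMeasurable (fun s => ∫ t in Ioo a b, k s t * x t) (intervalMeasure a b) :=
    (hk.1.mul (Lp.aestronglyMeasurable x).comp_snd).integral_prod_right'
  refine (memLp_two_iff_integrable_sq hm).2 ?_
  refine (hk.integrable_sq.integral_prod_left.mul_const (‖x‖ ^ 2)).mono' (hm.pow 2) ?_
  filter_upwards [hk.sq_integral_le x] with s hs
  rw [Real.norm_of_nonneg (sq_nonneg _)]
  exact hs

/-- The integral operator `(K x)(s) = ∫ₐᵇ k(s, t) x(t) dt` as a bounded operator on `L²(a, b)`. -/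
def integralOperator (a b : ℝ) (k : ℝ → ℝ → ℝ) (hk : SquareIntegrableKernel a b k) :
    L2 a b →L[ℝ] L2 a b :=
  LinearMap.mkContinuous
    { toFun := fun x => (hk.integral_memLp x).toLp _
      map_add' := by
        intro x y
        rw [← MemLp.toLp_add]
        refine MemLp.toLp_congr _ _ ?_
        filter_upwards [hk.section_memLp] with s hs
        refine Eq.trans ?_ (integral_add (hs.integrable_mul (Lp.memLp x))
          (hs.integrable_mul (Lp.memLp y)))
        refine integral_congr_ae ?_
        filter_upwards [Lp.coeFn_add x y] with t ht
        rw [ht, Pi.add_apply, mul_add]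
      map_smul' := by
        intro c x
        rw [RingHom.id_apply, ← MemLp.toLp_const_smul]
        refine MemLp.toLp_congr _ _ (Eventually.of_forall fun s => ?_)
        rw [Pi.smul_apply, smul_eq_mul, ← integral_const_mul]
        refine integral_congr_ae ?_
        filter_upwards [Lp.coeFn_smul c x] with t ht
        rw [ht, Pi.smul_apply, smul_eq_mul]
        ring }
    (Real.sqrt (∫ s in Ioo a b, ∫ t in Ioo a b, k s t ^ 2))
    (by
      intro x
      have h0 : (0 : ℝ) ≤ ∫ s in Ioo a b, ∫ t in Ioo a b, k s t ^ 2 :=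
        integral_nonneg fun s => integral_nonneg fun t => sq_nonneg _
      refine abs_le_of_sq_le_sq' ?_ (by positivity) |>.2
      rw [mul_pow, Real.sq_sqrt h0, ← real_inner_self_eq_norm_sq, L2.inner_def,
        ← integral_mul_const]
      have hx := hk.integral_memLp x
      refine (integral_congr_ae ?_).trans_le (integral_mono_ae hx.integrable_sq
        (hk.integrable_sq.integral_prod_left.mul_const (‖x‖ ^ 2)) (hk.sq_integral_le x))
      filter_upwards [hx.coeFn_toLp] with s hs
      simp only [LinearMap.coe_mk, AddHom.coe_mk, hs]
      simp [sq])

theorem integralOperator_apply (hk : SquareIntegrableKernel a b k) (x : L2 a b) :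
    integralOperator a b k hk x =ᵐ[intervalMeasure a b] fun s => ∫ t in Ioo a b, k s t * x t :=
  (hk.integral_memLp x).coeFn_toLp

end IntegralOperator

/-- `u ∈ H^m(a, b)`: for each `j ≤ m` the function `u ∈ L²(a, b)` has a weak derivative of order `j`
in `L²(a, b)`. -/
def MemSobolev (a b : ℝ) (m : ℕ) (u : L2 a b) : Prop :=
  ∀ j ≤ m, ∃ g : L2 a b, ∀ φ : ℝ → ℝ,
    ContDiff ℝ (⊤ : ℕ∞) φ → HasCompactSupport φ → tsupport φ ⊆ Ioo a b →
      ∫ t in Ioo a b, u t * iteratedDeriv j φ t = (-1) ^ j * ∫ t in Ioo a b, g t * φ t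

/-- The value at `s ∈ [a, b]` of the continuous representative on `[a, b]` of a class
`u ∈ L²(a, b)` (for `a < b` it is unique if it exists; it exists for `u ∈ H^m(a, b)`, `m ≥ 1`). -/
def pointValue {a b : ℝ} (u : L2 a b) (s : ℝ) : ℝ :=
  Classical.epsilon
    (fun g : ℝ → ℝ => ContinuousOn g (Icc a b) ∧ g =ᵐ[intervalMeasure a b] u) s

/-- `x` is the best-approximate solution of `K x = y`: the least-squares solution of least norm. -/
def IsBestApproxSolution {a b : ℝ} (K : L2 a b →L[ℝ] L2 a b) (y x : L2 a b) : Prop :=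
  (∀ z, ‖K x - y‖ ≤ ‖K z - y‖) ∧
    ∀ x', (∀ z, ‖K x' - y‖ ≤ ‖K z - y‖) → ‖x‖ ≤ ‖x'‖

/-- The functional `|K x - w|_n² + α ‖x‖²`, where `|v|_n² = (1 / n) ∑ᵢ v(sᵢ)²`. -/
def tikhonov {a b : ℝ} (K : L2 a b →L[ℝ] L2 a b) {n : ℕ} (pts w : Fin n → ℝ) (α : ℝ)
    (x : L2 a b) : ℝ :=
  (1 / (n : ℝ)) * ∑ i, (pointValue (K x) (pts i) - w i) ^ 2 + α * ‖x‖ ^ 2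

/-- `x` minimizes the sampled Tikhonov functional over `L²(a, b)`. -/
def IsTikhonovMinimizer {a b : ℝ} (K : L2 a b →L[ℝ] L2 a b) {n : ℕ} (pts w : Fin n → ℝ) (α : ℝ)
    (x : L2 a b) : Prop :=
  ∀ z, tikhonov K pts w α x ≤ tikhonov K pts w α z

/-- The regularized solution `x_{n,α}`: the minimizer of the sampled Tikhonov functional. -/
def regularizedSolution {a b : ℝ} (K : L2 a b →L[ℝ] L2 a b) {n : ℕ} (pts w : Fin n → ℝ)
    (α : ℝ) : L2 a b :=
  Classical.epsilon (IsTikhonovMinimizer K pts w α)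

/-- `h = h_max = max_{x ∈ [a, b]} min_i |x - sᵢ|`. -/
def meshSize (a b : ℝ) {n : ℕ} (pts : Fin n → ℝ) : ℝ :=
  ⨆ x : Icc a b, ⨅ i, |(x : ℝ) - pts i|

/-- Sampling points and noise: `n ≥ 1` points `a ≤ s₁ < ⋯ < sₙ ≤ b` that are quasi-uniform with
constant `B`, that is `h_max ≤ B * h_min` with `h_min = min_{i ≠ j} |sᵢ - sⱼ|`, and independent noise
variables `e(s₁), …, e(sₙ)` of mean zero and variance at most `σ²`. -/
structure NoisySampling (a b B σ : ℝ) where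
  n : ℕ
  n_pos : 0 < n
  pts : Fin n → ℝ
  pts_mem : ∀ i, pts i ∈ Icc a b
  pts_strictMono : StrictMono pts
  quasiUniform : ∀ i j, i ≠ j → meshSize a b pts ≤ B * |pts i - pts j|
  Ω : Type*
  [mΩ : MeasurableSpace Ω]
  P : Measure Ω
  [prob : IsProbabilityMeasure P]
  e : Fin n → Ω → ℝ
  e_memLp : ∀ i, MemLp (e i) 2 P
  e_indep : iIndepFun e P
  e_mean : ∀ i, ∫ ω, e i ω ∂P = 0
  e_var : ∀ i, Var[e i; P] ≤ σ ^ 2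

attribute [instance] NoisySampling.mΩ NoisySampling.prob

namespace NoisySampling

variable {a b B σ : ℝ}

/-- The mesh size `h` of the sampling points. -/
def h (D : NoisySampling a b B σ) : ℝ := meshSize a b D.pts

/-- The observed data `w(sᵢ) = y(sᵢ) + e(sᵢ)`. -/
def data (D : NoisySampling a b B σ) (y : L2 a b) (ω : D.Ω) (i : Fin D.n) : ℝ :=
  pointValue y (D.pts i) + D.e i ω

/-- The regularized solution `x_{n,α}` computed from the noisy data. -/
def solution (D : NoisySampling a b B σ) (K : L2 a b →L[ℝ] L2 a b) (y : L2 a b) (α : ℝ)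
    (ω : D.Ω) : L2 a b :=
  regularizedSolution K D.pts (D.data y ω) α

end NoisySampling

/-- A singular system `(s_j; φ_j, ψ_j)` of `K`: positive singular values (repeated according to
multiplicity), and orthonormal systems with `K φ_j = s_j ψ_j`, `K* ψ_j = s_j φ_j`, where
`(φ_j)` is complete in `N(K)^⊥`. -/
structure SingularSystem {a b : ℝ} (K : L2 a b →L[ℝ] L2 a b) (ι : Type*) where
  s : ι → ℝ
  φ : ι → L2 a b
  ψ : ι → L2 a b
  s_pos : ∀ j, 0 < s j
  φ_orthonormal : Orthonormal ℝ φ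
  ψ_orthonormal : Orthonormal ℝ ψ
  map_φ : ∀ j, K (φ j) = s j • ψ j
  adjoint_map_ψ : ∀ j, ContinuousLinearMap.adjoint K (ψ j) = s j • φ j
  φ_complete : (Submodule.span ℝ (Set.range φ)).topologicalClosure = K.kerᗮ

namespace SingularSystem

variable {a b : ℝ} {K : L2 a b →L[ℝ] L2 a b} {ι : Type*}

/-- `W = {f ∈ N(K)^⊥ : ∑ⱼ f_j² / s_j < ∞}` with `f_j = (f, φ_j)`. -/
def W (S : SingularSystem K ι) : Set (L2 a b) :=
  {f | f ∈ K.kerᗮ ∧ Summable fun j => inner ℝ f (S.φ j) ^ 2 / S.s j}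

/-- `‖f‖_W = (∑ⱼ f_j² / s_j)^{1/2}`. -/
def normW (S : SingularSystem K ι) (f : L2 a b) : ℝ :=
  Real.sqrt (∑' j, inner ℝ f (S.φ j) ^ 2 / S.s j)

/-- The dual norm `‖u‖_{W*} = sup_{0 ≠ v ∈ W} |(u, v)| / ‖v‖_W`. -/
def normWDual (S : SingularSystem K ι) (u : L2 a b) : ℝ :=
  sSup {r | ∃ v ∈ S.W, v ≠ 0 ∧ r = |inner ℝ u v| / S.normW v}

end SingularSystem

end WeakTikhonov

end

open WeakTikhonov

/-! The range condition and the closed graph theorem bound the `m`-th weak derivative of `K x` by a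
multiple of `‖x‖`. Hence each evaluation `x ↦ (K x)(sᵢ)` is a bounded functional with a representer
`tᵢ`, and the sampled Tikhonov functional is a quadratic on a Hilbert space. Its energy form is `α
(x, z) + n⁻¹ ∑ⱼ (tⱼ, x)(tⱼ, z)`; if `gᵢ` solves the normal equation with right-hand side `tᵢ`, the
minimizer for data `w` is `n⁻¹ ∑ wᵢ gᵢ`.

The error splits into the error for exact data, whose energy is at most `α ‖x†‖²` (`bias_le`), and
the noise part, whose expected energy is at most `n⁻² ∑ (tᵢ, gᵢ) σ²` by independence
(`integral_form_noise_le`). Two inequalities for functions in `H^m` make these useful. The sampling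
inequality (`exists_norm_sq_le_sampling`) bounds `‖K x‖²` by a multiple of the energy as soon as `α
≥ h^(2m)` and the points are quasi-uniform. The interpolation inequality
(`exists_pointValue_sq_le`), taken at scale `δ = α^(1/(2m))`, then bounds `(tᵢ, gᵢ)` by a multiple
of `α^(-1/(2m))`. Both come from one local estimate: on a short window a function in `H^m` is close
to a polynomial of degree less than `m`, and that polynomial is controlled by `m` separated values.

The dual norm squared is `∑ sⱼ uⱼ²`, which lies between `‖K u‖²` and `‖u‖²`: by Young's inequality
it is at most `(c⁻¹ ‖K u‖² + c ‖u‖²) / 2`, and `c = √α` makes this a multiple of `α^(-1/2)` times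
the energy. Multiplying the two energy bounds by `α^(-1/2)` gives the theorem. The singular system
exists because the sampling inequality also exhibits `K` as a norm limit of finite-rank operators.
-/

namespace WeakTikhonov

/-! ### Test functions on an interval. -/

/-- Smooth functions with compact support in `(a, b)`. -/
structure IsTestFunction (a b : ℝ) (φ : ℝ → ℝ) : Prop where
  contDiff : ContDiff ℝ (⊤ : ℕ∞) φ
  hasCompactSupport : HasCompactSupport φ
  tsupport_subset : tsupport φ ⊆ Ioo a b

namespace IsTestFunction

variable {a b : ℝ} {φ : ℝ → ℝ}

theorem eq_zero_of_notMem (hφ : IsTestFunction a b φ) {t : ℝ} (ht : t ∉ Ioo a b) : φ t = 0 :=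
  image_eq_zero_of_notMem_tsupport fun h => ht (hφ.tsupport_subset h)

theorem deriv (hφ : IsTestFunction a b φ) : IsTestFunction a b (deriv φ) where
  contDiff := (contDiff_infty_iff_deriv.1 hφ.contDiff).2
  hasCompactSupport := hφ.hasCompactSupport.deriv
  tsupport_subset := (tsupport_deriv_subset (𝕜 := ℝ)).trans hφ.tsupport_subset

theorem memLp (hφ : IsTestFunction a b φ) (p : ENNReal) : MemLp φ p (intervalMeasure a b) :=
  (hφ.contDiff.continuous.memLp_of_hasCompactSupport hφ.hasCompactSupport).restrict _

theorem setIntegral_eq (hφ : IsTestFunction a b φ) (u : ℝ → ℝ) :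
    ∫ t in Ioo a b, u t * φ t = ∫ t, u t * φ t :=
  setIntegral_eq_integral_of_forall_compl_eq_zero fun t ht => by
    rw [hφ.eq_zero_of_notMem ht, mul_zero]

/-- A test function of integral zero is the derivative of a test function. -/
theorem exists_deriv_eq (hφ : IsTestFunction a b φ) (h0 : ∫ t, φ t = 0) :
    ∃ Φ, IsTestFunction a b Φ ∧ _root_.deriv Φ = φ := by
  rcases (tsupport φ).eq_empty_or_nonempty with he | hne
  · have : φ = 0 := tsupport_eq_empty_iff.1 he
    exact ⟨0, ⟨contDiff_const, HasCompactSupport.zero, by simp [tsupport]⟩, by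
      rw [this]; ext x; simp⟩
  -- The primitive is based at the left end `c` of the support. It vanishes beyond the right end `d`
  -- because the total integral is zero, so its support stays in `[c, d] ⊂ (a, b)`.
  obtain ⟨c, hc⟩ := hφ.hasCompactSupport.isCompact.exists_isLeast hne
  obtain ⟨d, hd⟩ := hφ.hasCompactSupport.isCompact.exists_isGreatest hne
  have hcd : c ≤ d := hc.2 hd.1
  have hsupp : ∀ t, t ∉ Icc c d → φ t = 0 := fun t ht =>
    image_eq_zero_of_notMem_tsupport fun h => ht ⟨hc.2 h, hd.2 h⟩
  have hcont := hφ.contDiff.continuous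
  have hderiv : ∀ x, HasDerivAt (fun x => ∫ t in c..x, φ t) (φ x) x := fun x =>
    intervalIntegral.integral_hasDerivAt_right (hcont.intervalIntegrable _ _)
      (hcont.stronglyMeasurableAtFilter _ _) hcont.continuousAt
  have hd' : _root_.deriv (fun x => ∫ t in c..x, φ t) = φ := funext fun x => (hderiv x).deriv
  have hzero : ∀ x, x ∉ Icc c d → ∫ t in c..x, φ t = 0 := by
    intro x hx
    rcases lt_or_ge x c with h | h
    · rw [intervalIntegral.integral_symm, intervalIntegral.integral_of_le h.le,
        integral_Ioc_eq_integral_Ioo, setIntegral_eq_zero_of_forall_eq_zero, neg_zero]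
      intro t ht
      exact hsupp t fun h' => absurd ht.2 (not_lt.2 h'.1)
    · have hdx : d < x := by
        by_contra h'
        exact hx ⟨h, not_lt.1 h'⟩
      rw [intervalIntegral.integral_of_le h, ← integral_Icc_eq_integral_Ioc,
        setIntegral_eq_integral_of_forall_compl_eq_zero, h0]
      intro t ht
      exact hsupp t fun h' => ht ⟨h'.1, h'.2.trans hdx.le⟩
  have hts : tsupport (fun x => ∫ t in c..x, φ t) ⊆ Icc c d := by
    refine closure_minimal (fun x hx => ?_) isClosed_Icc
    by_contra h
    exact hx (hzero x h)
  refine ⟨fun x => ∫ t in c..x, φ t, ⟨?_, ?_, ?_⟩, hd'⟩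
  · refine contDiff_infty_iff_deriv.2 ⟨fun x => (hderiv x).differentiableAt, ?_⟩
    rw [hd']
    exact hφ.contDiff
  · exact HasCompactSupport.of_support_subset_isCompact isCompact_Icc
      (subset_closure.trans hts)
  · refine hts.trans fun x hx => ⟨?_, ?_⟩
    · exact (hφ.tsupport_subset hc.1).1.trans_le hx.1
    · exact hx.2.trans_lt (hφ.tsupport_subset hd.1).2

theorem sub_const_mul {ψ : ℝ → ℝ} (hφ : IsTestFunction a b φ) (hψ : IsTestFunction a b ψ) (c : ℝ) :
    IsTestFunction a b (fun t => φ t - c * ψ t) := by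
  refine ⟨hφ.contDiff.sub (contDiff_const.mul hψ.contDiff),
    hφ.hasCompactSupport.sub hψ.hasCompactSupport.mul_left, ?_⟩
  refine (tsupport_sub _ _).trans (union_subset hφ.tsupport_subset ?_)
  exact (tsupport_mul_subset_right (f := fun _ => c)).trans hψ.tsupport_subset

theorem exists_integral_eq_one (hab : a < b) : ∃ φ, IsTestFunction a b φ ∧ ∫ t, φ t = 1 := by
  let f : ContDiffBump ((a + b) / 2) :=
    ⟨(b - a) / 8, (b - a) / 4, by linarith, by linarith⟩
  refine ⟨f.normed volume, ⟨f.contDiff_normed, f.hasCompactSupport_normed, ?_⟩,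
    f.integral_normed⟩
  rw [f.tsupport_normed_eq, Real.closedBall_eq_Icc]
  intro t ht
  simp only [f] at ht
  constructor <;> linarith [ht.1, ht.2]

end IsTestFunction

/-! ### Weak derivatives of first order and primitives. -/

section WeakDerivative

variable {a b : ℝ} {u g : ℝ → ℝ}

theorem ae_eq_zero_of_forall_testFunction (hu : IntegrableOn u (Ioo a b))
    (h : ∀ φ, IsTestFunction a b φ → ∫ t in Ioo a b, u t * φ t = 0) :
    u =ᵐ[intervalMeasure a b] 0 := by
  have := isOpen_Ioo.ae_eq_zero_of_integral_contDiff_smul_eq_zero (μ := volume)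
    hu.locallyIntegrableOn (fun φ h1 h2 h3 => by
      have hφ : IsTestFunction a b φ := ⟨h1, h2, h3⟩
      rw [← h φ hφ, hφ.setIntegral_eq]
      simp only [smul_eq_mul, mul_comm])
  rw [Filter.EventuallyEq, ae_restrict_iff' measurableSet_Ioo]
  exact this

theorem IsTestFunction.integrable_mul {φ : ℝ → ℝ} (hφ : IsTestFunction a b φ)
    (hu : IntegrableOn u (Ioo a b)) : IntegrableOn (fun t => u t * φ t) (Ioo a b) := by
  obtain ⟨C, hC⟩ := hφ.hasCompactSupport.exists_bound_of_continuous hφ.contDiff.continuous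
  exact hu.mul_bdd (c := C) hφ.contDiff.continuous.aestronglyMeasurable (Eventually.of_forall hC)

/-- The lemma of du Bois-Reymond. -/
theorem ae_eq_const_of_weakDeriv_eq_zero (hab : a < b) (hu : IntegrableOn u (Ioo a b))
    (h : ∀ φ, IsTestFunction a b φ → ∫ t in Ioo a b, u t * deriv φ t = 0) :
    ∃ c, u =ᵐ[intervalMeasure a b] fun _ => c := by
  obtain ⟨φ₀, hφ₀, h1⟩ := IsTestFunction.exists_integral_eq_one hab
  have hone : ∀ φ, IsTestFunction a b φ → ∫ t in Ioo a b, φ t = ∫ t, φ t := fun φ hφ => by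
    simpa using hφ.setIntegral_eq (fun _ => 1)
  have hint : ∀ φ, IsTestFunction a b φ → Integrable φ := fun φ hφ =>
    hφ.contDiff.continuous.integrable_of_hasCompactSupport hφ.hasCompactSupport
  -- The constant is the mean of `u` against the unit-mass bump `φ₀`. Subtracting `(∫ ψ) φ₀` from a
  -- test function `ψ` leaves integral zero, hence a derivative, against which `u` vanishes.
  refine ⟨∫ t in Ioo a b, u t * φ₀ t, ?_⟩
  set c := ∫ t in Ioo a b, u t * φ₀ t with hc
  have hconst : IntegrableOn (fun _ : ℝ => c) (Ioo a b) := integrableOn_const (by simp)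
  have key := ae_eq_zero_of_forall_testFunction (u := fun t => u t - c) (hu.sub hconst) ?_
  · filter_upwards [key] with t ht
    simpa [sub_eq_zero] using ht
  · intro ψ hψ
    have hη := hψ.sub_const_mul hφ₀ (∫ t, ψ t)
    obtain ⟨Φ, hΦ, hd⟩ := hη.exists_deriv_eq (by
      rw [integral_sub (hint _ hψ) ((hint _ hφ₀).const_mul _), integral_const_mul, h1]
      ring)
    have h2 := h Φ hΦ
    rw [hd] at h2
    have e1 : ∫ t in Ioo a b, u t * (ψ t - (∫ t, ψ t) * φ₀ t) =
        (∫ t in Ioo a b, u t * ψ t) - (∫ t, ψ t) * c := by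
      rw [hc, ← integral_const_mul, ← integral_sub (hψ.integrable_mul hu)
        ((hφ₀.integrable_mul hu).const_mul _)]
      congr 1
      ext t
      ring
    have e2 : ∫ t in Ioo a b, (u t - c) * ψ t =
        (∫ t in Ioo a b, u t * ψ t) - c * ∫ t, ψ t := by
      rw [← hone ψ hψ, ← integral_const_mul, ← integral_sub (hψ.integrable_mul hu)
        ((hint ψ hψ).integrableOn.const_mul _)]
      congr 1
      ext t
      ring
    rw [e2]
    rw [e1] at h2
    linarith

/-- Integration by parts for absolutely continuous functions; the boundary terms vanish with the
test function. -/
theorem setIntegral_primitive_mul_deriv (hab : a < b) (hg : IntegrableOn g (Ioo a b)) {φ : ℝ → ℝ}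
    (hφ : IsTestFunction a b φ) :
    ∫ t in Ioo a b, (∫ τ in a..t, g τ) * deriv φ t = -∫ t in Ioo a b, g t * φ t := by
  have hgi : IntervalIntegrable g volume a b :=
    (intervalIntegrable_iff_integrableOn_Ioo_of_le hab.le).2 hg
  have hG := hgi.absolutelyContinuousOnInterval_intervalIntegral (c := a) (by simp)
  have hφ' : AbsolutelyContinuousOnInterval φ a b :=
    ((hφ.contDiff.of_le (by norm_cast)).contDiffOn).absolutelyContinuousOnInterval
  have := hG.integral_mul_deriv_eq_deriv_mul hφ'
  rw [hφ.eq_zero_of_notMem (t := a) (by simp), hφ.eq_zero_of_notMem (t := b) (by simp)] at this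
  simp only [mul_zero, sub_zero, zero_sub] at this
  rw [← integral_Ioc_eq_integral_Ioo, ← integral_Ioc_eq_integral_Ioo,
    ← intervalIntegral.integral_of_le hab.le, ← intervalIntegral.integral_of_le hab.le, this]
  congr 1
  refine intervalIntegral.integral_congr_ae ?_
  filter_upwards [hgi.ae_hasDerivAt_integral] with t ht htm
  rw [(ht (uIoc_subset_uIcc htm) a (by simp)).deriv]

/-- A function with an integrable weak derivative is a primitive of the latter. -/
theorem ae_eq_primitive_of_weakDeriv (hab : a < b) (hu : IntegrableOn u (Ioo a b))
    (hg : IntegrableOn g (Ioo a b))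
    (h : ∀ φ, IsTestFunction a b φ →
      ∫ t in Ioo a b, u t * deriv φ t = -∫ t in Ioo a b, g t * φ t) :
    ∃ c, u =ᵐ[intervalMeasure a b] fun t => c + ∫ τ in a..t, g τ := by
  have hgi : IntervalIntegrable g volume a b :=
    (intervalIntegrable_iff_integrableOn_Ioo_of_le hab.le).2 hg
  have hGc := (hgi.absolutelyContinuousOnInterval_intervalIntegral (c := a) (by simp)).continuousOn
  have hG : IntegrableOn (fun t => ∫ τ in a..t, g τ) (Ioo a b) :=
    (hGc.integrableOn_uIcc).mono_set (by rw [uIcc_of_le hab.le]; exact Ioo_subset_Icc_self)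
  obtain ⟨c, hc⟩ := ae_eq_const_of_weakDeriv_eq_zero (u := fun t => u t - ∫ τ in a..t, g τ) hab
    (hu.sub hG) (fun φ hφ => by
      simp only [sub_mul]
      rw [integral_sub (hφ.deriv.integrable_mul hu) (hφ.deriv.integrable_mul hG), h φ hφ,
        setIntegral_primitive_mul_deriv hab hg hφ, sub_self])
  refine ⟨c, ?_⟩
  filter_upwards [hc] with t ht
  linarith

end WeakDerivative

/-! ### Polynomial approximation by repeated integration. -/

section Taylor

open Polynomial

theorem exists_antiderivative (Q : ℝ[X]) {n : ℕ} (hn : 0 < n) (hQ : Q.degree < n) :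
    ∃ P : ℝ[X], P.degree < (n + 1 : ℕ) ∧ derivative P = Q := by
  refine ⟨∑ i ∈ Finset.range n, monomial (i + 1) (Q.coeff i / (i + 1)), ?_, ?_⟩
  · rw [← mem_degreeLT]
    refine Submodule.sum_mem _ fun i hi => mem_degreeLT.2 ?_
    refine (degree_monomial_le _ _).trans_lt ?_
    have := Finset.mem_range.1 hi
    exact_mod_cast Nat.succ_lt_succ this
  · rw [derivative_sum]
    conv_rhs => rw [Q.as_sum_range' n (by
      by_cases h : Q = 0
      · subst h
        simpa using hn
      · exact (natDegree_lt_iff_degree_lt h).2 hQ)]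
    refine Finset.sum_congr rfl fun i _ => ?_
    rw [derivative_monomial]
    congr 1
    push_cast
    field_simp

/-- Cauchy–Schwarz against the constant one, read off from the nonnegative integral of `(|g| - l)²`
with `l` the mean of `|g|`. -/
theorem sq_intervalIntegral_abs_le {g : ℝ → ℝ} {c d : ℝ} (hcd : c ≤ d)
    (hg : IntervalIntegrable g volume c d)
    (hg2 : IntervalIntegrable (fun t => g t ^ 2) volume c d) :
    (∫ t in c..d, |g t|) ^ 2 ≤ (d - c) * ∫ t in c..d, g t ^ 2 := by
  rcases hcd.eq_or_lt with rfl | h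
  · simp
  set l := (∫ t in c..d, |g t|) / (d - c) with hl
  have hpos : 0 < d - c := sub_pos.2 h
  have h1 : 0 ≤ ∫ t in c..d, (|g t| - l) ^ 2 :=
    intervalIntegral.integral_nonneg hcd fun t _ => sq_nonneg _
  have h2 : ∫ t in c..d, (|g t| - l) ^ 2 =
      (∫ t in c..d, g t ^ 2) - 2 * l * (∫ t in c..d, |g t|) + l ^ 2 * (d - c) := by
    have e : ∀ t, (|g t| - l) ^ 2 = g t ^ 2 - 2 * l * |g t| + l ^ 2 := fun t => by
      rw [sub_sq, sq_abs]
      ring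
    simp only [e]
    rw [intervalIntegral.integral_add (hg2.sub (hg.abs.const_mul _)) (by simp),
      intervalIntegral.integral_sub hg2 (hg.abs.const_mul _), intervalIntegral.integral_const_mul,
      intervalIntegral.integral_const, smul_eq_mul]
    ring
  have h3 : ∫ t in c..d, |g t| = l * (d - c) := by rw [hl]; field_simp
  rw [h2, h3] at h1
  rw [h3]
  nlinarith

/-- Taylor's formula for a chain of primitives. -/
theorem exists_polynomial_abs_sub_le {c d : ℝ} (hcd : c ≤ d) (m : ℕ) (U : ℕ → ℝ → ℝ)
    (hint : ∀ j ≤ m, IntervalIntegrable (U (j + 1)) volume c d)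
    (hU : ∀ j ≤ m, ∀ t ∈ Icc c d, U j t = U j c + ∫ τ in c..t, U (j + 1) τ) :
    ∃ P : ℝ[X], P.degree < (m + 1 : ℕ) ∧
      ∀ t ∈ Icc c d, |U 0 t - P.eval t| ≤ (d - c) ^ m * ∫ τ in c..d, |U (m + 1) τ| := by
  induction m generalizing U with
  | zero =>
    refine ⟨C (U 0 c), degree_C_le.trans_lt (by norm_num), fun t ht => ?_⟩
    rw [hU 0 le_rfl t ht, eval_C, add_sub_cancel_left, pow_zero, one_mul]
    have hi := hint 0 le_rfl
    refine (intervalIntegral.abs_integral_le_integral_abs ht.1).trans ?_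
    exact intervalIntegral.integral_mono_interval le_rfl ht.1 ht.2
      (Eventually.of_forall fun _ => abs_nonneg _) hi.abs
  | succ m ih =>
    obtain ⟨Q, hQ, hQU⟩ := ih (fun j => U (j + 1)) (fun j hj => hint (j + 1) (by omega))
      (fun j hj => hU (j + 1) (by omega))
    obtain ⟨P, hP, hPQ⟩ := exists_antiderivative Q m.succ_pos hQ
    -- The constant makes the polynomial agree with `U 0` at `c`, so the error is the integral of
    -- the previous error and gains one factor `d - c`.
    refine ⟨P + C (U 0 c - P.eval c), ?_, fun t ht => ?_⟩
    · refine (degree_add_le _ _).trans_lt (max_lt hP (degree_C_le.trans_lt ?_))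
      exact_mod_cast Nat.succ_pos _
    · have hPi : ∫ τ in c..t, Q.eval τ = P.eval t - P.eval c := by
        refine intervalIntegral.integral_eq_sub_of_hasDerivAt (f := fun x => P.eval x) (fun x _ => ?_)
          (Q.continuous.intervalIntegrable _ _)
        rw [← hPQ]
        exact P.hasDerivAt x
      have hi : IntervalIntegrable (U 1) volume c t :=
        (hint 0 (by omega)).mono_set (by
          rw [uIcc_of_le ht.1, uIcc_of_le hcd]
          exact Icc_subset_Icc_right ht.2)
      have e : U 0 t - (P + C (U 0 c - P.eval c)).eval t = ∫ τ in c..t, (U 1 τ - Q.eval τ) := by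
        rw [intervalIntegral.integral_sub hi (Q.continuous.intervalIntegrable _ _), hPi,
          hU 0 (by omega) t ht]
        simp
        ring
      have hE : 0 ≤ (d - c) ^ m * ∫ τ in c..d, |U (m + 1 + 1) τ| :=
        (abs_nonneg _).trans (hQU t ht)
      rw [e, ← Real.norm_eq_abs]
      refine (intervalIntegral.norm_integral_le_of_norm_le_const fun x hx => ?_).trans
        (b := (d - c) ^ m * (∫ τ in c..d, |U (m + 1 + 1) τ|) * |t - c|) ?_
      · rw [uIoc_of_le ht.1] at hx
        exact hQU x ⟨hx.1.le, hx.2.trans ht.2⟩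
      · rw [abs_of_nonneg (sub_nonneg.2 ht.1), pow_succ]
        have : t - c ≤ d - c := by linarith [ht.2]
        calc _ ≤ (d - c) ^ m * (∫ τ in c..d, |U (m + 1 + 1) τ|) * (d - c) :=
              mul_le_mul_of_nonneg_left this hE
          _ = (d - c) ^ m * (d - c) * ∫ τ in c..d, |U (m + 1 + 1) τ| := by ring

end Taylor

/-! ### Continuous representatives of Sobolev functions. -/

/-- `g` is the weak derivative of order `j` of `u` on `(a, b)`. -/
def IsWeakDeriv (a b : ℝ) (j : ℕ) (u g : ℝ → ℝ) : Prop :=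
  ∀ φ, IsTestFunction a b φ →
    ∫ t in Ioo a b, u t * iteratedDeriv j φ t = (-1) ^ j * ∫ t in Ioo a b, g t * φ t

section Representative

variable {a b : ℝ} {m : ℕ}

theorem MemSobolev.exists_isWeakDeriv {u : L2 a b} (hu : MemSobolev a b m u) {j : ℕ} (hj : j ≤ m) :
    ∃ g : L2 a b, IsWeakDeriv a b j u g := by
  obtain ⟨g, hg⟩ := hu j hj
  exact ⟨g, fun φ hφ => hg φ hφ.1 hφ.2 hφ.3⟩

theorem L2.integrableOn (u : L2 a b) : IntegrableOn u (Ioo a b) :=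
  (Lp.memLp u).integrable (by norm_num)

theorem L2.intervalIntegrable (u : L2 a b) {c d : ℝ} (hac : a ≤ c) (hcd : c ≤ d) (hdb : d ≤ b) :
    IntervalIntegrable u volume c d :=
  (intervalIntegrable_iff_integrableOn_Ioo_of_le hcd).2
    ((L2.integrableOn u).mono_set (Ioo_subset_Ioo hac hdb))

theorem L2.intervalIntegrable_sq (u : L2 a b) {c d : ℝ} (hac : a ≤ c) (hcd : c ≤ d) (hdb : d ≤ b) :
    IntervalIntegrable (fun t => u t ^ 2) volume c d :=
  (intervalIntegrable_iff_integrableOn_Ioo_of_le hcd).2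
    (IntegrableOn.mono_set (Lp.memLp u).integrable_sq (Ioo_subset_Ioo hac hdb))

theorem L2.norm_sq_eq (hab : a ≤ b) (u : L2 a b) : ‖u‖ ^ 2 = ∫ t in a..b, u t ^ 2 := by
  rw [← real_inner_self_eq_norm_sq, L2.inner_def, intervalIntegral.integral_of_le hab,
    integral_Ioc_eq_integral_Ioo]
  congr 1
  ext t
  simp [sq]

theorem IsWeakDeriv.deriv_of_succ {j : ℕ} {u g g' : ℝ → ℝ} (hg : IsWeakDeriv a b j u g)
    (hg' : IsWeakDeriv a b (j + 1) u g') {φ : ℝ → ℝ} (hφ : IsTestFunction a b φ) :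
    ∫ t in Ioo a b, g t * deriv φ t = -∫ t in Ioo a b, g' t * φ t := by
  have h1 := hg _ hφ.deriv
  have h2 := hg' φ hφ
  rw [← iteratedDeriv_succ', h2, pow_succ] at h1
  have : ((-1 : ℝ) ^ j) ≠ 0 := by positivity
  have h3 : (-1 : ℝ) ^ j * (∫ t in Ioo a b, g t * deriv φ t) =
    (-1) ^ j * (-∫ t in Ioo a b, g' t * φ t) := by rw [← h1]; ring
  exact mul_left_cancel₀ this h3

theorem IsWeakDeriv.ae_eq_of_zero {u g : ℝ → ℝ} (hu : IntegrableOn u (Ioo a b))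
    (hgi : IntegrableOn g (Ioo a b)) (h : IsWeakDeriv a b 0 u g) : g =ᵐ[intervalMeasure a b] u := by
  have := ae_eq_zero_of_forall_testFunction (u := fun t => g t - u t) (hgi.sub hu) fun φ hφ => by
    have h0 := h φ hφ
    simp only [iteratedDeriv_zero, pow_zero, one_mul] at h0
    simp only [sub_mul]
    rw [integral_sub (hφ.integrable_mul hgi) (hφ.integrable_mul hu), h0, sub_self]
  filter_upwards [this] with t ht
  simpa [sub_eq_zero] using ht

theorem intervalIntegral_congr_of_ae {u v : ℝ → ℝ} (h : u =ᵐ[intervalMeasure a b] v) {c d : ℝ}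
    (hac : a ≤ c) (hcd : c ≤ d) (hdb : d ≤ b) : ∫ t in c..d, u t = ∫ t in c..d, v t := by
  rw [intervalIntegral.integral_of_le hcd, intervalIntegral.integral_of_le hcd,
    integral_Ioc_eq_integral_Ioo, integral_Ioc_eq_integral_Ioo]
  exact integral_congr_ae (ae_restrict_of_ae_restrict_of_subset (Ioo_subset_Ioo hac hdb) h)

/-- `f` is continuous on `[a, b]` and on each subinterval `[c, d]` it differs from a polynomial of
degree less than `m` by at most `(d - c)^(m - 1/2) ‖g‖`, as does a function with weak derivative `g`
of order `m`. -/
structure HasTaylorBound (a b : ℝ) (m : ℕ) (f g : ℝ → ℝ) : Prop where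
  continuousOn : ContinuousOn f (Icc a b)
  exists_polynomial : ∀ c d, a ≤ c → c ≤ d → d ≤ b → ∃ P : Polynomial ℝ, P.degree < m ∧
    ∀ t ∈ Icc c d, (f t - P.eval t) ^ 2 ≤ (d - c) ^ (2 * m - 1) * ∫ τ in c..d, g τ ^ 2

/-- Each weak derivative of order below `m` is a.e. a primitive of the next one. Taking these
primitives as representatives gives an exact chain for Taylor's formula, and Cauchy–Schwarz turns
the `L¹` remainder into the `L²` one. -/
theorem MemSobolev.exists_hasTaylorBound (hab : a < b) (hm : 0 < m) {u g : L2 a b}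
    (hu : MemSobolev a b m u) (hg : IsWeakDeriv a b m u g) :
    ∃ f : ℝ → ℝ, f =ᵐ[intervalMeasure a b] u ∧ HasTaylorBound a b m f g := by
  -- The derivative of order `m` is pinned to the given `g`; orders above `m` receive the irrelevant
  -- value zero.
  have hex : ∀ j, ∃ v : L2 a b, (j ≤ m → IsWeakDeriv a b j u v) ∧ (j = m → v = g) := by
    intro j
    by_cases hj : j = m
    · exact ⟨g, fun _ => hj ▸ hg, fun _ => rfl⟩
    · by_cases hj' : j ≤ m
      · obtain ⟨v, hv⟩ := hu.exists_isWeakDeriv hj'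
        exact ⟨v, fun _ => hv, fun h => absurd h hj⟩
      · exact ⟨0, fun h => absurd h hj', fun h => absurd h hj⟩
  choose v hv hvm using hex
  have hprim : ∀ j, ∃ c : ℝ, j < m →
      (v j : ℝ → ℝ) =ᵐ[intervalMeasure a b] fun t => c + ∫ τ in a..t, v (j + 1) τ := by
    intro j
    by_cases hj : j < m
    · obtain ⟨c, hc⟩ := ae_eq_primitive_of_weakDeriv hab (L2.integrableOn (v j))
        (L2.integrableOn (v (j + 1)))
        fun φ hφ => (hv j hj.le).deriv_of_succ (hv (j + 1) hj) hφ
      exact ⟨c, fun _ => hc⟩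
    · exact ⟨0, fun h => absurd h hj⟩
  choose c hc using hprim
  let U : ℕ → ℝ → ℝ := fun j => if j < m then fun t => c j + ∫ τ in a..t, v (j + 1) τ else v j
  have hUlt : ∀ j, j < m → U j = fun t => c j + ∫ τ in a..t, v (j + 1) τ := fun j hj => by
    simp only [U, if_pos hj]
  have hUv : ∀ j ≤ m, U j =ᵐ[intervalMeasure a b] v j := by
    intro j _
    by_cases hj : j < m
    · rw [hUlt j hj]
      exact (hc j hj).symm
    · simp only [U, if_neg hj]
      rfl
  have hUint : ∀ j ≤ m, ∀ s t, a ≤ s → s ≤ t → t ≤ b → IntervalIntegrable (U j) volume s t := by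
    intro j hj s t h1 h2 h3
    have : IntegrableOn (U j) (Ioo a b) := (L2.integrableOn (v j)).congr (hUv j hj).symm
    exact (intervalIntegrable_iff_integrableOn_Ioo_of_le h2).2
      (this.mono_set (Ioo_subset_Ioo h1 h3))
  have hstep : ∀ j < m, ∀ s t, a ≤ s → s ≤ t → t ≤ b →
      U j t = U j s + ∫ τ in s..t, U (j + 1) τ := by
    intro j hj s t h1 h2 h3
    rw [intervalIntegral_congr_of_ae (hUv (j + 1) hj) h1 h2 h3, hUlt j hj]
    simp only
    rw [add_assoc, intervalIntegral.integral_add_adjacent_intervals]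
    · exact L2.intervalIntegrable _ le_rfl h1 (h2.trans h3)
    · exact L2.intervalIntegrable _ h1 h2 h3
  refine ⟨U 0, ?_, ?_, fun s t h1 h2 h3 => ?_⟩
  · exact (hUv 0 hm.le).trans
      ((hv 0 hm.le).ae_eq_of_zero (L2.integrableOn _) (L2.integrableOn _))
  · rw [hUlt 0 hm]
    refine continuousOn_const.add ?_
    have := ((L2.intervalIntegrable (v (0 + 1)) le_rfl hab.le
      le_rfl).absolutelyContinuousOnInterval_intervalIntegral (c := a) (by simp)).continuousOn
    rwa [uIcc_of_le hab.le] at this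
  · obtain ⟨n, rfl⟩ : ∃ n, m = n + 1 := ⟨m - 1, by omega⟩
    obtain ⟨P, hP, hPU⟩ := exists_polynomial_abs_sub_le h2 n U
      (fun j hj => hUint (j + 1) (by omega) s t h1 h2 h3)
      (fun j hj τ hτ => hstep j (by omega) s τ h1 hτ.1 (hτ.2.trans h3))
    refine ⟨P, hP, fun τ hτ => ?_⟩
    have hUg : U (n + 1) = g := by
      simp only [U, lt_irrefl, if_false, hvm (n + 1) rfl]
    rw [hUg] at hPU
    have hsq := pow_le_pow_left₀ (abs_nonneg _) (hPU τ hτ) 2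
    rw [sq_abs, mul_pow] at hsq
    refine hsq.trans ?_
    calc _ ≤ ((t - s) ^ n) ^ 2 * ((t - s) * ∫ τ in s..t, g τ ^ 2) :=
          mul_le_mul_of_nonneg_left (sq_intervalIntegral_abs_le h2
            (L2.intervalIntegrable g h1 h2 h3) (L2.intervalIntegrable_sq g h1 h2 h3)) (sq_nonneg _)
      _ = _ := by
        rw [show 2 * (n + 1) - 1 = 2 * n + 1 by omega]
        ring

end Representative

/-! ### Lagrange interpolation at separated nodes. -/

section Interpolation

open Polynomial

/-- Each factor of a Lagrange basis polynomial is a quotient of a distance inside `[c, d]` by a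
distance between nodes, hence at most `(d - c) / r`. There are fewer than `m` such factors, and
padding to `m` is allowed because the ratio is at least one. -/
theorem abs_eval_le_of_separated {m : ℕ} {P : ℝ[X]} (hP : P.degree < m) {p : Fin m → ℝ} {c d r : ℝ}
    (hr : 0 < r) (hp : ∀ j, p j ∈ Icc c d) (hsep : ∀ i j, i ≠ j → r ≤ |p i - p j|)
    (hcd : r ≤ d - c) {t : ℝ} (ht : t ∈ Icc c d) :
    |P.eval t| ≤ ((d - c) / r) ^ m * ∑ j, |P.eval (p j)| := by
  have hinj : Function.Injective p := fun i j hij => by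
    by_contra h
    have := hsep i j h
    rw [hij, sub_self, abs_zero] at this
    linarith
  have hq : 1 ≤ (d - c) / r := (one_le_div hr).2 hcd
  have hI := Lagrange.eq_interpolate (s := Finset.univ) (v := p) (f := P) hinj.injOn (by simpa using hP)
  conv_lhs => rw [hI]
  rw [Lagrange.interpolate_apply, eval_finsetSum, Finset.mul_sum]
  refine (Finset.abs_sum_le_sum_abs _ _).trans (Finset.sum_le_sum fun j _ => ?_)
  rw [eval_mul, eval_C, abs_mul, mul_comm]
  refine mul_le_mul_of_nonneg_right ?_ (abs_nonneg _)
  rw [Lagrange.basis, eval_prod, Finset.abs_prod]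
  calc _ ≤ ∏ _i ∈ Finset.univ.erase j, ((d - c) / r) := by
        refine Finset.prod_le_prod (fun _ _ => abs_nonneg _) fun i hi => ?_
        have hij : j ≠ i := (Finset.ne_of_mem_erase hi).symm
        rw [Lagrange.basisDivisor]
        simp only [eval_mul, eval_C, eval_sub, eval_X, abs_mul, abs_inv]
        rw [mul_comm, ← div_eq_mul_inv]
        refine div_le_div₀ (by linarith) ?_ hr (hsep j i hij)
        rw [abs_le]
        constructor <;> linarith [ht.1, ht.2, (hp i).1, (hp i).2]
    _ ≤ ((d - c) / r) ^ m := by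
        rw [Finset.prod_const]
        exact pow_le_pow_right₀ hq ((Finset.card_le_univ _).trans (by simp))

end Interpolation

/-! ### Local estimate, interpolation inequality and sampling inequality. -/

variable {a b : ℝ} {m : ℕ} {f g : ℝ → ℝ}

/-- On the window, `f` equals a polynomial of degree less than `m` up to the Taylor remainder. One
node in each of `m` cells of width `2h`, with gaps of `2h` between cells, controls the polynomial;
its nodal values are those of `f` up to the same remainder. -/
theorem HasTaylorBound.exists_local_bound (m : ℕ) (hm : 0 < m) :
    ∃ C : ℝ, 0 < C ∧ ∀ (a b : ℝ) (f g : ℝ → ℝ), HasTaylorBound a b m f g →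
      ∀ (c h : ℝ), 0 < h → a ≤ c → c + 4 * m * h ≤ b →
      ∀ p : Fin m → ℝ, (∀ j : Fin m, p j ∈ Icc (c + (4 * (j : ℕ) + 1) * h) (c + (4 * (j : ℕ) + 3) * h)) →
      ∀ t ∈ Icc c (c + 4 * m * h), f t ^ 2 ≤
        C * (∑ j, f (p j) ^ 2 + h ^ (2 * m - 1) * ∫ τ in c..(c + 4 * m * h), g τ ^ 2) := by
  have hm1 : (1 : ℝ) ≤ m := by exact_mod_cast hm
  -- The Lagrange factor: window length `4mh` over node separation `2h`, to the power `m`.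
  set A : ℝ := (2 * m) ^ m with hA
  refine ⟨(2 + 4 * m ^ 2 * A ^ 2) * (4 * m) ^ (2 * m - 1) + 4 * m * A ^ 2, by positivity, ?_⟩
  intro a b f g hf c h hh hac hcb p hp t ht
  have hcd : c ≤ c + 4 * m * h := by
    have : 0 ≤ 4 * m * h := by positivity
    linarith
  obtain ⟨P, hP, hPf⟩ := hf.exists_polynomial c (c + 4 * m * h) hac hcd hcb
  rw [add_sub_cancel_left] at hPf
  set G := ∫ τ in c..(c + 4 * m * h), g τ ^ 2 with hG
  have hG0 : 0 ≤ G := intervalIntegral.integral_nonneg hcd fun _ _ => sq_nonneg _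
  set E := (4 * m * h) ^ (2 * m - 1) * G with hE
  have hpI : ∀ j, p j ∈ Icc c (c + 4 * m * h) := fun j => by
    have h1 : ((j : ℕ) : ℝ) + 1 ≤ m := by exact_mod_cast j.2
    refine ⟨le_trans ?_ (hp j).1, (hp j).2.trans ?_⟩
    · have : 0 ≤ (4 * ((j : ℕ) : ℝ) + 1) * h := by positivity
      linarith
    · have : (4 * ((j : ℕ) : ℝ) + 3) * h ≤ 4 * m * h :=
        mul_le_mul_of_nonneg_right (by linarith) hh.le
      linarith
  have hlt : ∀ i j : Fin m, i < j → 2 * h ≤ p j - p i := fun i j hij => by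
    have h1 : ((i : ℕ) : ℝ) + 1 ≤ (j : ℕ) := by exact_mod_cast hij
    have h2 := (hp j).1
    have h3 := (hp i).2
    nlinarith
  have hsep : ∀ i j, i ≠ j → 2 * h ≤ |p i - p j| := fun i j hij => by
    rcases lt_or_gt_of_ne hij with h' | h'
    · rw [abs_sub_comm]
      exact (hlt i j h').trans (le_abs_self _)
    · exact (hlt j i h').trans (le_abs_self _)
  have hPt := abs_eval_le_of_separated hP (r := 2 * h) (by positivity) hpI hsep
    (by rw [add_sub_cancel_left]; nlinarith) ht
  rw [add_sub_cancel_left, show 4 * m * h / (2 * h) = 2 * (m : ℝ) by field_simp; ring, ← hA] at hPt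
  have hPt2 : P.eval t ^ 2 ≤ A ^ 2 * (m * ∑ j, P.eval (p j) ^ 2) := by
    have h1 := pow_le_pow_left₀ (abs_nonneg _) hPt 2
    rw [sq_abs, mul_pow] at h1
    refine h1.trans (mul_le_mul_of_nonneg_left ?_ (sq_nonneg _))
    have h2 := sq_sum_le_card_mul_sum_sq (s := Finset.univ) (f := fun j => |P.eval (p j)|)
    simpa only [sq_abs, Finset.card_univ, Fintype.card_fin] using h2
  have hsum : ∑ j, P.eval (p j) ^ 2 ≤ 2 * m * E + 2 * ∑ j, f (p j) ^ 2 := by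
    calc _ ≤ ∑ j, (2 * E + 2 * f (p j) ^ 2) := Finset.sum_le_sum fun j _ => by
          have := hPf (p j) (hpI j)
          nlinarith [sq_nonneg (f (p j) - P.eval (p j) - f (p j)), sq_nonneg (f (p j) - P.eval (p j) + f (p j))]
      _ = _ := by
          rw [Finset.sum_add_distrib, Finset.sum_const, ← Finset.mul_sum, Finset.card_univ,
            Fintype.card_fin, nsmul_eq_mul]
          ring
  have hft : f t ^ 2 ≤ 2 * E + 2 * P.eval t ^ 2 := by
    have := hPf t ht
    nlinarith [sq_nonneg (f t - P.eval t - P.eval t)]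
  set S := ∑ j, f (p j) ^ 2 with hS
  have hS0 : 0 ≤ S := Finset.sum_nonneg fun _ _ => sq_nonneg _
  have h1 : f t ^ 2 ≤ (2 + 4 * m ^ 2 * A ^ 2) * E + 4 * m * A ^ 2 * S := by
    have : A ^ 2 * (m * ∑ j, P.eval (p j) ^ 2) ≤ A ^ 2 * (m * (2 * m * E + 2 * S)) := by
      gcongr
    linarith
  have hEe : E = (4 * m) ^ (2 * m - 1) * (h ^ (2 * m - 1) * G) := by
    rw [hE, mul_pow]
    ring
  rw [hEe] at h1
  refine h1.trans ?_
  have h2 : 0 ≤ h ^ (2 * m - 1) * G := by positivity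
  have h3 : 0 ≤ (2 + 4 * m ^ 2 * A ^ 2) * (4 * m) ^ (2 * m - 1) * S := by positivity
  have h4 : 0 ≤ 4 * m * A ^ 2 * (h ^ (2 * m - 1) * G) := by positivity
  linarith

theorem intervalIntegral_mono_of_nonneg {u : ℝ → ℝ} (hu : ∀ t, 0 ≤ u t) {a b c d : ℝ} (hac : a ≤ c)
    (hcd : c ≤ d) (hdb : d ≤ b) (hi : IntervalIntegrable u volume a b) :
    ∫ t in c..d, u t ≤ ∫ t in a..b, u t :=
  intervalIntegral.integral_mono_interval hac hcd hdb (Eventually.of_forall hu) hi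

theorem HasTaylorBound.intervalIntegrable_sq (hf : HasTaylorBound a b m f g) {c d : ℝ}
    (hac : a ≤ c) (hcd : c ≤ d) (hdb : d ≤ b) :
    IntervalIntegrable (fun t => f t ^ 2) volume c d := by
  refine ((hf.continuousOn.pow 2).mono ?_).intervalIntegrable
  rw [uIcc_of_le hcd]
  exact Icc_subset_Icc hac hdb

/-- Interpolation between `L²` and `H^m` for the maximum norm. -/
theorem HasTaylorBound.exists_sup_bound (m : ℕ) (hm : 0 < m) :
    ∃ C : ℝ, 0 < C ∧ ∀ (a b : ℝ) (f g : ℝ → ℝ), HasTaylorBound a b m f g →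
      IntervalIntegrable (fun t => g t ^ 2) volume a b →
      ∀ δ, 0 < δ → δ ≤ b - a → ∀ t ∈ Icc a b, f t ^ 2 ≤
        C * (δ⁻¹ * (∫ τ in a..b, f τ ^ 2) + δ ^ (2 * m - 1) * ∫ τ in a..b, g τ ^ 2) := by
  obtain ⟨C, hC, H⟩ := HasTaylorBound.exists_local_bound m hm
  have hm1 : (1 : ℝ) ≤ m := by exact_mod_cast hm
  refine ⟨C * (2 * m ^ 2 + 1), by positivity, ?_⟩
  intro a b f g hf hg δ hδ hδab t ht
  set h : ℝ := δ / (4 * m) with hh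
  have hpos : 0 < h := by positivity
  have h4 : 4 * m * h = δ := by rw [hh]; field_simp
  -- The window of length `δ` starts at `t`, unless it would leave `[a, b]`, in which case it ends
  -- at `b`.
  obtain ⟨c, hac, hcb, htc⟩ : ∃ c, a ≤ c ∧ c + δ ≤ b ∧ t ∈ Icc c (c + δ) := by
    rcases le_total t (b - δ) with h' | h'
    · exact ⟨t, ht.1, by linarith, le_rfl, by linarith⟩
    · exact ⟨b - δ, by linarith, by linarith, h', by linarith [ht.2]⟩
  have hab : a ≤ b := ht.1.trans ht.2
  have hJ : ∀ j : Fin m, a ≤ c + (4 * (j : ℕ) + 1) * h ∧ c + (4 * (j : ℕ) + 3) * h ≤ b := by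
    intro j
    have h1 : ((j : ℕ) : ℝ) + 1 ≤ m := by exact_mod_cast j.2
    constructor
    · have : 0 ≤ (4 * ((j : ℕ) : ℝ) + 1) * h := by positivity
      linarith
    · have : (4 * ((j : ℕ) : ℝ) + 3) * h ≤ 4 * m * h :=
        mul_le_mul_of_nonneg_right (by linarith) hpos.le
      linarith
  have hle : ∀ j : Fin m, c + (4 * ((j : ℕ) : ℝ) + 1) * h ≤ c + (4 * (j : ℕ) + 3) * h := by
    intro j
    nlinarith
  -- The nodes are free here: in each cell take a minimum point of `f²`, where the value is at most
  -- the mean over the cell.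
  have hex : ∀ j : Fin m, ∃ p ∈ Icc (c + (4 * ((j : ℕ) : ℝ) + 1) * h) (c + (4 * (j : ℕ) + 3) * h),
      f p ^ 2 * (2 * h) ≤ ∫ τ in a..b, f τ ^ 2 := by
    intro j
    obtain ⟨p, hp, hmin⟩ := isCompact_Icc.exists_isMinOn (nonempty_Icc.2 (hle j))
      ((hf.continuousOn.pow 2).mono (Icc_subset_Icc (hJ j).1 (hJ j).2))
    refine ⟨p, hp, le_trans ?_ (intervalIntegral_mono_of_nonneg (fun t => sq_nonneg (f t))
      (hJ j).1 (hle j) (hJ j).2 (hf.intervalIntegrable_sq le_rfl hab le_rfl))⟩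
    have := intervalIntegral.integral_mono_on (hle j) (by simp : IntervalIntegrable
      (fun _ => f p ^ 2) volume _ _) (hf.intervalIntegrable_sq (hJ j).1 (hle j) (hJ j).2)
      (fun x hx => hmin hx)
    rw [intervalIntegral.integral_const, smul_eq_mul] at this
    refine le_trans (le_of_eq ?_) this
    ring
  choose p hp hpf using hex
  have key := H a b f g hf c h hpos hac (by rw [h4]; exact hcb) p hp t (by rw [h4]; exact htc)
  rw [h4] at key
  set F := ∫ τ in a..b, f τ ^ 2 with hF
  set G := ∫ τ in a..b, g τ ^ 2 with hG
  have hG' : ∫ τ in c..(c + δ), g τ ^ 2 ≤ G :=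
    intervalIntegral_mono_of_nonneg (fun t => sq_nonneg (g t)) hac (by linarith) hcb hg
  have hF0 : 0 ≤ F := intervalIntegral.integral_nonneg hab fun _ _ => sq_nonneg _
  have hG0 : 0 ≤ G := intervalIntegral.integral_nonneg hab fun _ _ => sq_nonneg _
  have hsum : ∑ j, f (p j) ^ 2 ≤ 2 * m ^ 2 * (δ⁻¹ * F) := by
    calc _ ≤ ∑ _j : Fin m, F / (2 * h) :=
          Finset.sum_le_sum fun j _ => (le_div_iff₀ (by positivity)).2 (hpf j)
      _ = _ := by
          rw [Finset.sum_const, Finset.card_univ, Fintype.card_fin, nsmul_eq_mul, hh]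
          field_simp
          ring
  have hhδ : h ^ (2 * m - 1) ≤ δ ^ (2 * m - 1) :=
    pow_le_pow_left₀ hpos.le (by rw [← h4]; nlinarith) _
  calc f t ^ 2 ≤ C * (2 * m ^ 2 * (δ⁻¹ * F) + δ ^ (2 * m - 1) * G) := by
        refine key.trans (mul_le_mul_of_nonneg_left (add_le_add hsum ?_) hC.le)
        exact mul_le_mul hhδ hG' (intervalIntegral.integral_nonneg (by linarith)
          fun _ _ => sq_nonneg _) (by positivity)
    _ ≤ _ := by
        rw [mul_assoc C]
        refine mul_le_mul_of_nonneg_left ?_ hC.le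
        have h1 : 0 ≤ δ⁻¹ * F := by positivity
        have h2 : 0 ≤ 2 * m ^ 2 * (δ ^ (2 * m - 1) * G) := by positivity
        linarith

/-- The sampling inequality. -/
theorem HasTaylorBound.exists_sampling_bound (m : ℕ) (hm : 0 < m) :
    ∃ C : ℝ, 0 < C ∧ ∀ (a b : ℝ) (f g : ℝ → ℝ), HasTaylorBound a b m f g →
      IntervalIntegrable (fun t => g t ^ 2) volume a b →
      ∀ (n : ℕ) (pts : Fin n → ℝ) (h : ℝ), 0 < h → 4 * m * h ≤ b - a →
      (∀ s ∈ Icc a b, ∃ i, |s - pts i| ≤ h) →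
      ∫ τ in a..b, f τ ^ 2 ≤
        C * (h * ∑ i, f (pts i) ^ 2 + h ^ (2 * m) * ∫ τ in a..b, g τ ^ 2) := by
  obtain ⟨C, hC, H⟩ := HasTaylorBound.exists_local_bound m hm
  have hm1 : (1 : ℝ) ≤ m := by exact_mod_cast hm
  refine ⟨4 * m * C * 2 ^ (2 * m), by positivity, ?_⟩
  intro a b f g hf hg n pts h hh hhab hcov
  have h4 : 0 < 4 * m * h := by positivity
  have hab : a ≤ b := by linarith
  set x := (b - a) / (4 * m * h) with hx
  have hx1 : 1 ≤ x := (one_le_div h4).2 hhab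
  set N := ⌊x⌋₊ with hN
  have hN1 : 1 ≤ N := Nat.one_le_floor_iff _ |>.2 hx1
  have hN1' : (1 : ℝ) ≤ N := by exact_mod_cast hN1
  have hNx : (N : ℝ) ≤ x := Nat.floor_le (by linarith)
  have hxN : x < N + 1 := Nat.lt_floor_add_one x
  have hba : b - a = x * (4 * m * h) := by rw [hx]; field_simp
  -- Enlarging `h` to `k` makes exactly `N` windows of length `4mk` tile `[a, b]`; since `N ≥ 1`,
  -- rounding costs at most a factor two.
  set k : ℝ := (b - a) / (4 * m * N) with hk
  have hkN : 4 * m * k * N = b - a := by rw [hk]; field_simp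
  have hhk : h ≤ k := by
    rw [hk, le_div_iff₀ (by positivity), hba]
    nlinarith
  have hk2 : k ≤ 2 * h := by
    rw [hk, div_le_iff₀ (by positivity), hba]
    nlinarith
  have hk0 : 0 < k := hh.trans_le hhk
  -- A cell has half-width `k ≥ h`, so it contains any sampling point within `h` of its centre.
  -- Indices from `m * N` on are given an arbitrary point.
  have hcenter : ∀ i : ℕ, ∃ q : Fin n, i < m * N →
      pts q ∈ Icc (a + (4 * i + 1) * k) (a + (4 * i + 3) * k) := by
    have hn : Nonempty (Fin n) := (hcov a ⟨le_rfl, hab⟩).nonempty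
    intro i
    by_cases hi : i < m * N
    · have hi' : (i : ℝ) + 1 ≤ m * N := by exact_mod_cast hi
      obtain ⟨q, hq⟩ := hcov (a + (4 * i + 2) * k) ⟨by
        have : 0 ≤ (4 * (i : ℝ) + 2) * k := by positivity
        linarith, by
        have : (4 * (i : ℝ) + 2) * k ≤ 4 * (m * N) * k :=
          mul_le_mul_of_nonneg_right (by linarith) hk0.le
        linarith⟩
      refine ⟨q, fun _ => ?_⟩
      rw [abs_le] at hq
      constructor <;> linarith [hq.1, hq.2]
    · exact ⟨Classical.arbitrary _, fun h => absurd h hi⟩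
  choose q hq using hcenter
  have hqinj : ∀ i < m * N, ∀ j < m * N, q i = q j → i = j := by
    have aux : ∀ i < m * N, ∀ j < m * N, q i = q j → ¬ i < j := by
      intro i hi j hj hij hlt
      have h1 := (hq i hi).2
      have h2 := (hq j hj).1
      rw [hij] at h1
      have h3 : (i : ℝ) + 1 ≤ j := by exact_mod_cast hlt
      nlinarith
    intro i hi j hj hij
    have := aux i hi j hj hij
    have := aux j hj i hi hij.symm
    omega
  let node : ℕ → ℝ := fun l => a + 4 * m * k * l
  have hnode_succ : ∀ l, node (l + 1) = node l + 4 * m * k := fun l => by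
    simp only [node]
    push_cast
    ring
  have hnode_le : ∀ l, a ≤ node l := fun l => by
    have : 0 ≤ 4 * m * k * l := by positivity
    simp only [node]
    linarith
  have hnode_ub : ∀ l < N, node (l + 1) ≤ b := fun l hl => by
    have h1 : (l : ℝ) + 1 ≤ N := by exact_mod_cast hl
    have : 4 * m * k * (l + 1) ≤ 4 * m * k * N := mul_le_mul_of_nonneg_left h1 (by positivity)
    simp only [node]
    push_cast
    linarith
  have hnode_mono : ∀ l, node l ≤ node (l + 1) := fun l => by
    have : 0 ≤ 4 * m * k := by positivity
    rw [hnode_succ]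
    linarith
  have hidx : ∀ l < N, ∀ j : Fin m, m * l + j < m * N := fun l hl j => by
    calc m * l + j < m * l + m := by omega
      _ = m * (l + 1) := by ring
      _ ≤ m * N := Nat.mul_le_mul_left _ hl
  have hloc : ∀ l ∈ Finset.range N, ∫ τ in node l..node (l + 1), f τ ^ 2 ≤
      4 * m * k * C * (∑ j : Fin m, f (pts (q (m * l + j))) ^ 2) +
        4 * m * C * k ^ (2 * m) * ∫ τ in node l..node (l + 1), g τ ^ 2 := by
    intro l hl
    have hl := Finset.mem_range.1 hl
    have hb := H a b f g hf (node l) k hk0 (hnode_le l)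
      (by rw [← hnode_succ]; exact hnode_ub l hl) (fun j => pts (q (m * l + j))) (fun j => by
        have := hq _ (hidx l hl j)
        push_cast at this
        simp only [node]
        constructor
        · refine le_trans (le_of_eq ?_) this.1
          ring
        · refine this.2.trans (le_of_eq ?_)
          ring)
    rw [← hnode_succ] at hb
    have := intervalIntegral.integral_mono_on (hnode_mono l)
      (hf.intervalIntegrable_sq (hnode_le l) (hnode_mono l) (hnode_ub l hl))
      (by simp : IntervalIntegrable (fun _ => C * (∑ j : Fin m, f (pts (q (m * l + j))) ^ 2 +
        k ^ (2 * m - 1) * ∫ τ in node l..node (l + 1), g τ ^ 2)) volume _ _) hb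
    refine this.trans (le_of_eq ?_)
    rw [intervalIntegral.integral_const, smul_eq_mul, hnode_succ, add_sub_cancel_left,
      show k ^ (2 * m) = k ^ (2 * m - 1) * k by rw [← pow_succ]; congr 1; omega]
    ring
  have hsum := Finset.sum_le_sum hloc
  rw [Finset.sum_add_distrib, ← Finset.mul_sum, ← Finset.mul_sum,
    intervalIntegral.sum_integral_adjacent_intervals (fun l hl => hf.intervalIntegrable_sq
      (hnode_le l) (hnode_mono l) (hnode_ub l hl)),
    intervalIntegral.sum_integral_adjacent_intervals (fun l hl => hg.mono_set (by
      rw [uIcc_of_le hab, uIcc_of_le (hnode_mono l)]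
      exact Icc_subset_Icc (hnode_le l) (hnode_ub l hl)))] at hsum
  have hn0 : node 0 = a := by simp [node]
  have hnN : node N = b := by simp only [node]; linarith
  rw [hn0, hnN] at hsum
  -- Disjoint cells hold distinct sampling points, so the double sum runs over part of the sample
  -- without repetition.
  have hS : ∑ l ∈ Finset.range N, ∑ j : Fin m, f (pts (q (m * l + j))) ^ 2 ≤
      ∑ i, f (pts i) ^ 2 := by
    rw [← Finset.sum_product', ← Finset.sum_image (s := Finset.range N ×ˢ Finset.univ)
      (g := fun x : ℕ × Fin m => q (m * x.1 + x.2)) (f := fun i => f (pts i) ^ 2)]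
    · exact Finset.sum_le_univ_sum_of_nonneg fun _ => sq_nonneg _
    · rintro ⟨l, j⟩ hlj ⟨l', j'⟩ hlj' heq
      simp only [Finset.coe_product, Finset.coe_range, Finset.coe_univ, mem_prod, mem_Iio, mem_univ,
        and_true] at hlj hlj'
      have h1 := hqinj _ (hidx l hlj j) _ (hidx l' hlj' j') heq
      have h2 : l = l' := by
        have := congrArg (· / m) h1
        simpa [Nat.mul_add_div hm, Nat.div_eq_of_lt j.2, Nat.div_eq_of_lt j'.2] using this
      subst h2
      have h3 : j = j' := Fin.ext (by omega)
      rw [h3]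
  set S := ∑ i, f (pts i) ^ 2 with hSd
  have hS0 : 0 ≤ S := Finset.sum_nonneg fun _ _ => sq_nonneg _
  set G := ∫ τ in a..b, g τ ^ 2 with hG
  have hG0 : 0 ≤ G := intervalIntegral.integral_nonneg hab fun _ _ => sq_nonneg _
  have h2m : (2 : ℝ) ≤ 2 ^ (2 * m) := by
    calc (2 : ℝ) = 2 ^ 1 := by norm_num
      _ ≤ _ := pow_le_pow_right₀ (by norm_num) (by omega)
  calc _ ≤ 4 * m * k * C * S + 4 * m * C * k ^ (2 * m) * G := by
        refine hsum.trans ?_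
        gcongr
    _ ≤ 4 * m * (2 ^ (2 * m) * h) * C * S + 4 * m * C * (2 * h) ^ (2 * m) * G := by
        have : k ≤ 2 ^ (2 * m) * h := hk2.trans (by gcongr)
        gcongr
    _ = _ := by
        rw [mul_pow]
        ring

variable {a b : ℝ} {m : ℕ}

/-! ### Point values of Sobolev classes. -/

section PointValue

theorem eqOn_Icc_of_ae_eq_intervalMeasure (hab : a < b) {f g : ℝ → ℝ}
    (h : f =ᵐ[intervalMeasure a b] g) (hf : ContinuousOn f (Icc a b))
    (hg : ContinuousOn g (Icc a b)) : EqOn f g (Icc a b) := by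
  refine Measure.eqOn_Icc_of_ae_eq volume hab.ne ?_ hf hg
  rwa [← Measure.restrict_congr_set Ioo_ae_eq_Icc]

/-- Continuous functions that agree a.e. on a nondegenerate interval agree on its closure, so the
choice hidden in `pointValue` does not matter there. -/
theorem pointValue_eqOn (hab : a < b) {u : L2 a b} {f : ℝ → ℝ} (hf : ContinuousOn f (Icc a b))
    (hfu : f =ᵐ[intervalMeasure a b] u) : EqOn (pointValue u) f (Icc a b) := by
  have h := Classical.epsilon_spec
    (p := fun g : ℝ → ℝ => ContinuousOn g (Icc a b) ∧ g =ᵐ[intervalMeasure a b] u) ⟨f, hf, hfu⟩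
  exact eqOn_Icc_of_ae_eq_intervalMeasure hab (h.2.trans hfu.symm) h.1 hf

theorem HasTaylorBound.congr {f f' g : ℝ → ℝ} (h : HasTaylorBound a b m f g)
    (hff : EqOn f' f (Icc a b)) : HasTaylorBound a b m f' g where
  continuousOn := h.continuousOn.congr hff
  exists_polynomial c d hc hcd hd := by
    obtain ⟨P, hP, H⟩ := h.exists_polynomial c d hc hcd hd
    refine ⟨P, hP, fun t ht => ?_⟩
    rw [hff ⟨hc.trans ht.1, ht.2.trans hd⟩]
    exact H t ht

theorem MemSobolev.pointValue_ae_eq_and_hasTaylorBound (hab : a < b) (hm : 0 < m) {u g : L2 a b}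
    (hu : MemSobolev a b m u) (hg : IsWeakDeriv a b m u g) :
    pointValue u =ᵐ[intervalMeasure a b] u ∧ HasTaylorBound a b m (pointValue u) g := by
  obtain ⟨f, hfu, hf⟩ := hu.exists_hasTaylorBound hab hm hg
  have h := pointValue_eqOn hab hf.continuousOn hfu
  refine ⟨?_, hf.congr h⟩
  refine Filter.EventuallyEq.trans ?_ hfu
  exact (ae_restrict_mem measurableSet_Ioo).mono fun t ht => h (Ioo_subset_Icc_self ht)

end PointValue

/-! ### Boundedness into the Sobolev space by the closed graph theorem. -/

section ClosedGraph

theorem IsTestFunction.iteratedDeriv {φ : ℝ → ℝ} (hφ : IsTestFunction a b φ) (j : ℕ) :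
    IsTestFunction a b (iteratedDeriv j φ) := by
  induction j with
  | zero => simpa using hφ
  | succ j ih =>
    rw [iteratedDeriv_succ]
    exact ih.deriv

theorem IsTestFunction.setIntegral_eq_inner {φ : ℝ → ℝ} (hφ : IsTestFunction a b φ) (u : L2 a b) :
    ∫ t in Ioo a b, u t * φ t = inner ℝ u ((hφ.memLp 2).toLp φ) := by
  rw [L2.inner_def]
  refine integral_congr_ae ?_
  filter_upwards [(hφ.memLp 2).coeFn_toLp] with t ht
  simp [ht, mul_comm]

theorem isWeakDeriv_iff_inner {j : ℕ} {u g : L2 a b} :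
    IsWeakDeriv a b j u g ↔ ∀ φ (hφ : IsTestFunction a b φ),
      inner ℝ u (((hφ.iteratedDeriv j).memLp 2).toLp _) =
        (-1) ^ j * inner ℝ g ((hφ.memLp 2).toLp φ) := by
  refine forall₂_congr fun φ hφ => ?_
  rw [(hφ.iteratedDeriv j).setIntegral_eq_inner, hφ.setIntegral_eq_inner]

theorem IsWeakDeriv.unique {j : ℕ} {u g g' : L2 a b} (h : IsWeakDeriv a b j u g)
    (h' : IsWeakDeriv a b j u g') : g = g' := by
  have := ae_eq_zero_of_forall_testFunction (u := fun t => g t - g' t)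
    ((L2.integrableOn g).sub (L2.integrableOn g')) fun φ hφ => by
      simp only [sub_mul]
      rw [integral_sub (hφ.integrable_mul (L2.integrableOn g))
        (hφ.integrable_mul (L2.integrableOn g')), sub_eq_zero]
      have h1 := h φ hφ
      rw [h' φ hφ] at h1
      exact (mul_left_cancel₀ (by positivity) h1).symm
  refine Lp.ext ?_
  filter_upwards [this] with t ht
  simpa [sub_eq_zero] using ht

theorem IsWeakDeriv.add {j : ℕ} {u u' g g' : L2 a b} (h : IsWeakDeriv a b j u g)
    (h' : IsWeakDeriv a b j u' g') :
    IsWeakDeriv a b j ((u + u' : L2 a b) : ℝ → ℝ) ((g + g' : L2 a b) : ℝ → ℝ) := by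
  rw [isWeakDeriv_iff_inner] at *
  intro φ hφ
  rw [inner_add_left, inner_add_left, h φ hφ, h' φ hφ, mul_add]

theorem IsWeakDeriv.smul {j : ℕ} {u g : L2 a b} (h : IsWeakDeriv a b j u g) (c : ℝ) :
    IsWeakDeriv a b j ((c • u : L2 a b) : ℝ → ℝ) ((c • g : L2 a b) : ℝ → ℝ) := by
  rw [isWeakDeriv_iff_inner] at *
  intro φ hφ
  rw [real_inner_smul_left, real_inner_smul_left, h φ hφ]
  ring

/-- Pairing with a fixed test function is continuous on `L²`. This closedness of the weak derivative
is what the closed graph theorem needs. -/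
theorem IsWeakDeriv.of_tendsto {j : ℕ} {u g : ℕ → L2 a b} {u₀ g₀ : L2 a b}
    (h : ∀ i, IsWeakDeriv a b j (u i) (g i)) (hu : Tendsto u atTop (𝓝 u₀))
    (hg : Tendsto g atTop (𝓝 g₀)) : IsWeakDeriv a b j u₀ g₀ := by
  simp only [isWeakDeriv_iff_inner] at *
  intro φ hφ
  refine tendsto_nhds_unique (hu.inner tendsto_const_nhds) ?_
  simp only [h _ φ hφ]
  exact (hg.inner tendsto_const_nhds).const_mul _

/-- By the closed graph theorem, an operator with range in `H^m` is bounded into `H^m`. -/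
theorem exists_weakDeriv_bound {K : L2 a b →L[ℝ] L2 a b} (hrange : ∀ x, MemSobolev a b m (K x)) :
    ∃ M : ℝ, 0 < M ∧ ∀ x, ∃ g : L2 a b, IsWeakDeriv a b m (K x) g ∧ ‖g‖ ≤ M * ‖x‖ := by
  choose D hD using fun x => (hrange x).exists_isWeakDeriv le_rfl
  let T : L2 a b →ₗ[ℝ] L2 a b :=
    { toFun := D
      map_add' := fun x y => by
        refine (hD (x + y)).unique ?_
        rw [map_add]
        exact (hD x).add (hD y)
      map_smul' := fun c x => by
        refine (hD (c • x)).unique ?_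
        rw [map_smul]
        exact (hD x).smul c }
  have hT : Continuous T := T.continuous_of_seq_closed_graph fun u x y hu hTu => by
    refine IsWeakDeriv.unique (IsWeakDeriv.of_tendsto (fun i => hD (u i))
      ((K.continuous.tendsto x).comp hu) hTu) (hD x)
  let T' : L2 a b →L[ℝ] L2 a b := ⟨T, hT⟩
  refine ⟨‖T'‖ + 1, by positivity, fun x => ⟨D x, hD x, ?_⟩⟩
  refine (T'.le_opNorm x).trans ?_
  gcongr
  linarith

end ClosedGraph

/-! ### The Sobolev inequalities applied to the range of the operator. -/

section Operator

variable {K : L2 a b →L[ℝ] L2 a b}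

theorem exists_hasTaylorBound_operator (hab : a < b) (hm : 0 < m)
    (hrange : ∀ x, MemSobolev a b m (K x)) :
    ∃ M : ℝ, 0 < M ∧ ∀ x, ∃ g : ℝ → ℝ, HasTaylorBound a b m (pointValue (K x)) g ∧
      IntervalIntegrable (fun t => g t ^ 2) volume a b ∧ ∫ t in a..b, g t ^ 2 ≤ M * ‖x‖ ^ 2 := by
  obtain ⟨M, hM, H⟩ := exists_weakDeriv_bound hrange
  refine ⟨M ^ 2, by positivity, fun x => ?_⟩
  obtain ⟨g, hg, hgM⟩ := H x
  refine ⟨g, ((hrange x).pointValue_ae_eq_and_hasTaylorBound hab hm hg).2,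
    L2.intervalIntegrable_sq g le_rfl hab.le le_rfl, ?_⟩
  rw [← L2.norm_sq_eq hab.le, ← mul_pow]
  exact pow_le_pow_left₀ (norm_nonneg _) hgM 2

theorem pointValue_ae_eq (hab : a < b) (hm : 0 < m) {u : L2 a b} (hu : MemSobolev a b m u) :
    pointValue u =ᵐ[intervalMeasure a b] u := by
  obtain ⟨g, hg⟩ := hu.exists_isWeakDeriv le_rfl
  exact (hu.pointValue_ae_eq_and_hasTaylorBound hab hm hg).1

theorem pointValue_continuousOn (hab : a < b) (hm : 0 < m) {u : L2 a b} (hu : MemSobolev a b m u) :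
    ContinuousOn (pointValue u) (Icc a b) := by
  obtain ⟨g, hg⟩ := hu.exists_isWeakDeriv le_rfl
  exact (hu.pointValue_ae_eq_and_hasTaylorBound hab hm hg).2.continuousOn

theorem integral_pointValue_sq (hab : a < b) (hm : 0 < m) {u : L2 a b} (hu : MemSobolev a b m u) :
    ∫ t in a..b, pointValue u t ^ 2 = ‖u‖ ^ 2 := by
  rw [L2.norm_sq_eq hab.le]
  refine intervalIntegral_congr_of_ae ?_ le_rfl hab.le le_rfl
  filter_upwards [pointValue_ae_eq hab hm hu] with t ht
  rw [ht]

theorem exists_pointValue_sq_le (hab : a < b) (hm : 0 < m)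
    (hrange : ∀ x, MemSobolev a b m (K x)) :
    ∃ C : ℝ, 0 < C ∧ ∀ s ∈ Icc a b, ∀ δ > 0, ∀ x,
      pointValue (K x) s ^ 2 ≤ C * δ⁻¹ * (‖K x‖ ^ 2 + δ ^ (2 * m) * ‖x‖ ^ 2) := by
  obtain ⟨C, hC, H⟩ := HasTaylorBound.exists_sup_bound m hm
  obtain ⟨M, hM, HM⟩ := exists_hasTaylorBound_operator hab hm hrange
  have hL : 0 < b - a := sub_pos.2 hab
  have small : ∀ s ∈ Icc a b, ∀ δ > 0, δ ≤ b - a → ∀ x,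
      pointValue (K x) s ^ 2 ≤ C * δ⁻¹ * (‖K x‖ ^ 2 + M * (δ ^ (2 * m) * ‖x‖ ^ 2)) := by
    intro s hs δ hδ hδL x
    obtain ⟨g, hg, hgi, hgM⟩ := HM x
    refine (H a b _ g hg hgi δ hδ hδL s hs).trans ?_
    rw [integral_pointValue_sq hab hm (hrange x)]
    have e : δ ^ (2 * m - 1) = δ⁻¹ * δ ^ (2 * m) := by
      rw [eq_inv_mul_iff_mul_eq₀ hδ.ne', ← pow_succ']
      congr 1
      omega
    rw [e]
    calc _ ≤ C * (δ⁻¹ * ‖K x‖ ^ 2 + δ⁻¹ * δ ^ (2 * m) * (M * ‖x‖ ^ 2)) := by gcongr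
      _ = _ := by ring
  set A := C * (1 + M) with hA
  set A' := C * (‖K‖ ^ 2 / (b - a) ^ (2 * m) + M) with hA'
  have hA0 : 0 < A := by positivity
  have hA'0 : 0 ≤ A' := by positivity
  refine ⟨A + A', by positivity, fun s hs δ hδ x => ?_⟩
  set R := ‖K x‖ ^ 2 + δ ^ (2 * m) * ‖x‖ ^ 2 with hR
  have hR0 : 0 ≤ δ⁻¹ * R := by positivity
  rcases le_total δ (b - a) with h | h
  · calc _ ≤ C * δ⁻¹ * (‖K x‖ ^ 2 + M * (δ ^ (2 * m) * ‖x‖ ^ 2)) := small s hs δ hδ h x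
      _ ≤ C * δ⁻¹ * ((1 + M) * R) := by
          refine mul_le_mul_of_nonneg_left ?_ (by positivity)
          have h1 : 0 ≤ δ ^ (2 * m) * ‖x‖ ^ 2 := by positivity
          have h2 : 0 ≤ M * ‖K x‖ ^ 2 := by positivity
          rw [hR]
          linarith
      _ = A * (δ⁻¹ * R) := by rw [hA]; ring
      _ ≤ (A + A') * (δ⁻¹ * R) := mul_le_mul_of_nonneg_right (by linarith) hR0
      _ = _ := by ring
  · have hpow : (b - a)⁻¹ * (b - a) ^ (2 * m) ≤ δ⁻¹ * δ ^ (2 * m) := by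
      have e : ∀ x : ℝ, 0 < x → x⁻¹ * x ^ (2 * m) = x ^ (2 * m - 1) := fun x hx => by
        rw [inv_mul_eq_iff_eq_mul₀ hx.ne', ← pow_succ']
        congr 1
        omega
      rw [e _ hL, e _ hδ]
      exact pow_le_pow_left₀ hL.le h _
    calc _ ≤ C * (b - a)⁻¹ * (‖K x‖ ^ 2 + M * ((b - a) ^ (2 * m) * ‖x‖ ^ 2)) :=
          small s hs _ hL le_rfl x
      _ ≤ C * (b - a)⁻¹ * ((‖K‖ * ‖x‖) ^ 2 + M * ((b - a) ^ (2 * m) * ‖x‖ ^ 2)) := by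
          gcongr
          exact K.le_opNorm x
      _ = A' * ((b - a)⁻¹ * (b - a) ^ (2 * m)) * ‖x‖ ^ 2 := by
          rw [hA']
          field_simp
      _ ≤ A' * (δ⁻¹ * δ ^ (2 * m)) * ‖x‖ ^ 2 := by gcongr
      _ = A' * (δ⁻¹ * (δ ^ (2 * m) * ‖x‖ ^ 2)) := by ring
      _ ≤ A' * (δ⁻¹ * R) := by
          gcongr
          rw [hR]
          have : 0 ≤ ‖K x‖ ^ 2 := by positivity
          linarith
      _ ≤ (A + A') * (δ⁻¹ * R) := mul_le_mul_of_nonneg_right (by linarith) hR0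
      _ = _ := by ring

theorem exists_norm_sq_le_sampling (hab : a < b) (hm : 0 < m)
    (hrange : ∀ x, MemSobolev a b m (K x)) :
    ∃ C : ℝ, 0 < C ∧ ∀ (n : ℕ) (pts : Fin n → ℝ) (h : ℝ), 0 < h →
      (∀ s ∈ Icc a b, ∃ i, |s - pts i| ≤ h) → ∀ x,
      ‖K x‖ ^ 2 ≤ C * (h * ∑ i, pointValue (K x) (pts i) ^ 2 + h ^ (2 * m) * ‖x‖ ^ 2) := by
  obtain ⟨C, hC, H⟩ := HasTaylorBound.exists_sampling_bound m hm
  obtain ⟨M, hM, HM⟩ := exists_hasTaylorBound_operator hab hm hrange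
  have hL : 0 < b - a := sub_pos.2 hab
  have hm0 : (0 : ℝ) < m := by exact_mod_cast hm
  set A := C * (1 + M) with hA
  -- The largest mesh size for which a window fits into `[a, b]`. For coarser meshes the bound `‖K
  -- x‖ ≤ ‖K‖ ‖x‖` suffices.
  set l := (b - a) / (4 * m) with hl
  have hl0 : 0 < l := by positivity
  set A' := ‖K‖ ^ 2 / l ^ (2 * m) with hA'
  have hA0 : 0 < A := by positivity
  have hA'0 : 0 ≤ A' := by positivity
  refine ⟨A + A', by positivity, fun n pts h hh hcov x => ?_⟩
  set S := ∑ i, pointValue (K x) (pts i) ^ 2 with hS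
  have hS0 : 0 ≤ S := Finset.sum_nonneg fun _ _ => sq_nonneg _
  have hR0 : 0 ≤ h * S + h ^ (2 * m) * ‖x‖ ^ 2 := by positivity
  rcases le_total h l with hle | hle
  · obtain ⟨g, hg, hgi, hgM⟩ := HM x
    have key := H a b _ g hg hgi n pts h hh (by
      rw [hl, le_div_iff₀ (by positivity)] at hle
      linarith) hcov
    rw [integral_pointValue_sq hab hm (hrange x)] at key
    calc _ ≤ C * (h * S + h ^ (2 * m) * (M * ‖x‖ ^ 2)) := by
          refine key.trans ?_
          gcongr
      _ ≤ C * ((1 + M) * (h * S + h ^ (2 * m) * ‖x‖ ^ 2)) := by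
          refine mul_le_mul_of_nonneg_left ?_ hC.le
          have h1 : 0 ≤ h ^ (2 * m) * ‖x‖ ^ 2 := by positivity
          have h2 : 0 ≤ M * (h * S) := by positivity
          linarith
      _ = A * (h * S + h ^ (2 * m) * ‖x‖ ^ 2) := by rw [hA]; ring
      _ ≤ _ := mul_le_mul_of_nonneg_right (by linarith) hR0
  · calc _ ≤ (‖K‖ * ‖x‖) ^ 2 := by
          gcongr
          exact K.le_opNorm x
      _ = A' * (l ^ (2 * m) * ‖x‖ ^ 2) := by
          rw [hA']
          field_simp
      _ ≤ A' * (h ^ (2 * m) * ‖x‖ ^ 2) := by gcongr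
      _ ≤ A' * (h * S + h ^ (2 * m) * ‖x‖ ^ 2) := by
          refine mul_le_mul_of_nonneg_left ?_ hA'0
          have : 0 ≤ h * S := by positivity
          linarith
      _ ≤ _ := mul_le_mul_of_nonneg_right (by linarith) hR0

/-- Evaluation is linear by uniqueness of the continuous representative and bounded by the
interpolation inequality at `δ = 1`; Riesz representation applies. -/
theorem exists_inner_eq_pointValue (hab : a < b) (hm : 0 < m)
    (hrange : ∀ x, MemSobolev a b m (K x)) {s : ℝ} (hs : s ∈ Icc a b) :
    ∃ t : L2 a b, ∀ x, inner ℝ t x = pointValue (K x) s := by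
  obtain ⟨C, hC, H⟩ := exists_pointValue_sq_le hab hm hrange
  have hc := fun x => pointValue_continuousOn hab hm (hrange x)
  have hae := fun x => pointValue_ae_eq hab hm (hrange x)
  let T : L2 a b →ₗ[ℝ] ℝ :=
    { toFun := fun x => pointValue (K x) s
      map_add' := fun x y => by
        refine pointValue_eqOn hab (f := fun s => pointValue (K x) s + pointValue (K y) s)
          ((hc x).add (hc y)) ?_ hs
        rw [map_add]
        filter_upwards [hae x, hae y, Lp.coeFn_add (K x) (K y)] with t h1 h2 h3
        rw [h1, h2, h3, Pi.add_apply]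
      map_smul' := fun c x => by
        refine pointValue_eqOn hab (f := fun s => c * pointValue (K x) s)
          (continuousOn_const.mul (hc x)) ?_ hs
        rw [map_smul]
        filter_upwards [hae x, Lp.coeFn_smul c (K x)] with t h1 h2
        rw [h1, h2, Pi.smul_apply, smul_eq_mul] }
  let T' : L2 a b →L[ℝ] ℝ := T.mkContinuous (Real.sqrt (C * (‖K‖ ^ 2 + 1))) fun x => by
    refine abs_le_of_sq_le_sq' ?_ (by positivity) |>.2
    rw [mul_pow, Real.sq_sqrt (by positivity), Real.norm_eq_abs, sq_abs]
    refine (H s hs 1 one_pos x).trans ?_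
    calc _ ≤ C * (1 : ℝ)⁻¹ * ((‖K‖ * ‖x‖) ^ 2 + 1 ^ (2 * m) * ‖x‖ ^ 2) := by
          gcongr
          exact K.le_opNorm x
      _ = _ := by
          rw [one_pow, inv_one]
          ring
  refine ⟨(InnerProductSpace.toDual ℝ (L2 a b)).symm T', fun x => ?_⟩
  rw [InnerProductSpace.toDual_symm_apply]
  rfl

end Operator

/-! ### The energy form, the normal equation and the error in energy. -/

section TikhonovForm

variable {H : Type*} [NormedAddCommGroup H] [InnerProductSpace ℝ H] {n : ℕ}

/-- The bilinear form of the normal equation of the sampled Tikhonov functional. -/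
noncomputable def tikhonovForm (t : Fin n → H) (α : ℝ) : H →L[ℝ] H →L[ℝ] ℝ :=
  α • (id (innerSL ℝ) : H →L[ℝ] H →L[ℝ] ℝ) + (n : ℝ)⁻¹ • ∑ j, (innerSL ℝ (t j)).smulRight (innerSL ℝ (t j))

theorem tikhonovForm_apply (t : Fin n → H) (α : ℝ) (x z : H) :
    tikhonovForm t α x z =
      α * inner ℝ x z + (n : ℝ)⁻¹ * ∑ j, inner ℝ (t j) x * inner ℝ (t j) z := by
  simp [tikhonovForm, _root_.sum_apply]
  exact Or.inl rfl

theorem tikhonovForm_comm (t : Fin n → H) (α : ℝ) (x z : H) :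
    tikhonovForm t α x z = tikhonovForm t α z x := by
  simp only [tikhonovForm_apply, real_inner_comm x z, mul_comm]

theorem tikhonovForm_self (t : Fin n → H) (α : ℝ) (x : H) :
    tikhonovForm t α x x = α * ‖x‖ ^ 2 + (n : ℝ)⁻¹ * ∑ j, inner ℝ (t j) x ^ 2 := by
  simp only [tikhonovForm_apply, real_inner_self_eq_norm_sq, sq]

theorem mul_norm_sq_le_tikhonovForm (t : Fin n → H) (α : ℝ) (x : H) :
    α * ‖x‖ ^ 2 ≤ tikhonovForm t α x x := by
  rw [tikhonovForm_self]
  have : 0 ≤ (n : ℝ)⁻¹ * ∑ j, inner ℝ (t j) x ^ 2 :=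
    mul_nonneg (by positivity) (Finset.sum_nonneg fun _ _ => sq_nonneg _)
  linarith

theorem sum_sq_le_tikhonovForm (t : Fin n → H) {α : ℝ} (hα : 0 ≤ α) (x : H) :
    (n : ℝ)⁻¹ * ∑ j, inner ℝ (t j) x ^ 2 ≤ tikhonovForm t α x x := by
  rw [tikhonovForm_self]
  have : 0 ≤ α * ‖x‖ ^ 2 := by positivity
  linarith

theorem tikhonovForm_self_nonneg (t : Fin n → H) {α : ℝ} (hα : 0 ≤ α) (x : H) :
    0 ≤ tikhonovForm t α x x :=
  (by positivity : 0 ≤ α * ‖x‖ ^ 2).trans (mul_norm_sq_le_tikhonovForm t α x)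

theorem tikhonovForm_add_self_le (t : Fin n → H) {α : ℝ} (hα : 0 ≤ α) (x z : H) :
    tikhonovForm t α (x + z) (x + z) ≤
      2 * tikhonovForm t α x x + 2 * tikhonovForm t α z z := by
  have h := tikhonovForm_self_nonneg t hα (x - z)
  simp only [map_add, map_sub, _root_.add_apply, _root_.sub_apply] at h ⊢
  linarith

/-- Lax–Milgram, with coercivity constant `α`. -/
theorem exists_tikhonovForm_eq_inner [CompleteSpace H] (t : Fin n → H) {α : ℝ} (hα : 0 < α)
    (y : H) : ∃ g, ∀ z, tikhonovForm t α g z = inner ℝ y z := by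
  have hco : IsCoercive (tikhonovForm t α) := ⟨α, hα, fun x => by
    have := mul_norm_sq_le_tikhonovForm t α x
    rwa [sq, ← mul_assoc] at this⟩
  refine ⟨hco.continuousLinearEquivOfBilin.symm y, fun z => ?_⟩
  rw [← hco.continuousLinearEquivOfBilin_apply, ContinuousLinearEquiv.apply_symm_apply]

/-- The solutions of the normal equation with right-hand sides `tᵢ`. -/
def IsNormalSolution (t : Fin n → H) (α : ℝ) (g : Fin n → H) : Prop :=
  ∀ i z, tikhonovForm t α (g i) z = inner ℝ (t i) z

theorem exists_isNormalSolution [CompleteSpace H] (t : Fin n → H) {α : ℝ} (hα : 0 < α) :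
    ∃ g, IsNormalSolution t α g := by
  choose g hg using fun i => exists_tikhonovForm_eq_inner t hα (t i)
  exact ⟨g, hg⟩

namespace IsNormalSolution

variable {t g : Fin n → H} {α : ℝ}

theorem form_sum (hg : IsNormalSolution t α g) (w : Fin n → ℝ) (z : H) :
    tikhonovForm t α ((n : ℝ)⁻¹ • ∑ i, w i • g i) z = (n : ℝ)⁻¹ * ∑ i, w i * inner ℝ (t i) z := by
  simp [_root_.sum_apply, hg _ z]

/-- Completing the square: up to a constant, the functional is the energy of the distance to the
solution of the normal equation. -/
theorem functional_eq (hg : IsNormalSolution t α g) (w : Fin n → ℝ) (x : H) :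
    (n : ℝ)⁻¹ * ∑ i, (inner ℝ (t i) x - w i) ^ 2 + α * ‖x‖ ^ 2 =
      tikhonovForm t α (x - (n : ℝ)⁻¹ • ∑ i, w i • g i) (x - (n : ℝ)⁻¹ • ∑ i, w i • g i) +
        ((n : ℝ)⁻¹ * ∑ i, w i ^ 2 - tikhonovForm t α ((n : ℝ)⁻¹ • ∑ i, w i • g i)
          ((n : ℝ)⁻¹ • ∑ i, w i • g i)) := by
  have h := hg.form_sum w x
  set y := (n : ℝ)⁻¹ • ∑ i, w i • g i
  have e : ∑ i, (inner ℝ (t i) x - w i) ^ 2 =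
      ∑ i, inner ℝ (t i) x ^ 2 - 2 * (∑ i, w i * inner ℝ (t i) x) + ∑ i, w i ^ 2 := by
    rw [Finset.mul_sum, ← Finset.sum_sub_distrib, ← Finset.sum_add_distrib]
    exact Finset.sum_congr rfl fun i _ => by ring
  have h2 := tikhonovForm_comm t α x y
  simp only [map_sub, _root_.sub_apply]
  rw [h2, h, tikhonovForm_self t α x, e]
  ring

/-- Testing the hypothesis at `g i` gives `q² ≤ L q` for `q = (tᵢ, gᵢ)`, since `q` is also the
energy of `g i`. -/
theorem inner_le (hg : IsNormalSolution t α g) (i : Fin n) {L : ℝ}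
    (hL : ∀ x, inner ℝ (t i) x ^ 2 ≤ L * tikhonovForm t α x x) (hL0 : 0 ≤ L) :
    inner ℝ (t i) (g i) ≤ L := by
  have h := hL (g i)
  rw [hg i (g i)] at h
  by_contra hlt
  push Not at hlt
  have : 0 < inner ℝ (t i) (g i) := hL0.trans_lt hlt
  nlinarith

theorem inner_eq_zero (hg : IsNormalSolution t α g) (hα : α ≠ 0) {z : H}
    (hz : ∀ i, inner ℝ (t i) z = 0) (i : Fin n) : inner ℝ (g i) z = 0 := by
  have h := hg i z
  rw [tikhonovForm_apply, hz i] at h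
  simpa [hz, hα] using h

/-- The approximation error for exact data. -/
theorem bias_le (hg : IsNormalSolution t α g) (hα : 0 ≤ α) (x : H) :
    tikhonovForm t α ((n : ℝ)⁻¹ • ∑ i, inner ℝ (t i) x • g i - x)
      ((n : ℝ)⁻¹ • ∑ i, inner ℝ (t i) x • g i - x) ≤ α * ‖x‖ ^ 2 := by
  have h : ∀ z, tikhonovForm t α ((n : ℝ)⁻¹ • ∑ i, inner ℝ (t i) x • g i - x) z =
      -(α * inner ℝ x z) := fun z => by
    rw [map_sub, _root_.sub_apply, hg.form_sum, tikhonovForm_apply]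
    ring
  -- Tested with `z` itself, the identity gives energy `-α (x, z)`. Young's inequality leaves `α
  -- ‖z‖² / 2`, which half of the energy absorbs.
  set z := (n : ℝ)⁻¹ • ∑ i, inner ℝ (t i) x • g i - x
  have h1 := mul_norm_sq_le_tikhonovForm t α z
  have h2 := h z
  have h3 : -(inner ℝ x z) ≤ ‖x‖ * ‖z‖ := (neg_le_abs _).trans (abs_real_inner_le_norm x z)
  have h4 : ‖x‖ * ‖z‖ ≤ (‖x‖ ^ 2 + ‖z‖ ^ 2) / 2 := by nlinarith [sq_nonneg (‖x‖ - ‖z‖)]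
  have h5 : α * -(inner ℝ x z) ≤ α * ((‖x‖ ^ 2 + ‖z‖ ^ 2) / 2) :=
    mul_le_mul_of_nonneg_left (h3.trans h4) hα
  linarith

theorem form_noise (hg : IsNormalSolution t α g) (e : Fin n → ℝ) :
    tikhonovForm t α ((n : ℝ)⁻¹ • ∑ i, e i • g i) ((n : ℝ)⁻¹ • ∑ i, e i • g i) =
      ∑ i, ∑ j, (n : ℝ)⁻¹ ^ 2 * inner ℝ (t i) (g j) * (e i * e j) := by
  rw [hg.form_sum, Finset.mul_sum]
  refine Finset.sum_congr rfl fun i _ => ?_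
  rw [inner_smul_right, inner_sum, Finset.mul_sum, Finset.mul_sum, Finset.mul_sum]
  refine Finset.sum_congr rfl fun j _ => ?_
  rw [inner_smul_right]
  ring

section Noise

variable {Ω : Type*} [MeasurableSpace Ω] {P : Measure Ω}
  {e : Fin n → Ω → ℝ} {σ : ℝ}

theorem integrable_form_noise (hg : IsNormalSolution t α g) (he : ∀ i, MemLp (e i) 2 P) :
    Integrable (fun ω => tikhonovForm t α ((n : ℝ)⁻¹ • ∑ i, e i ω • g i)
      ((n : ℝ)⁻¹ • ∑ i, e i ω • g i)) P := by
  simp only [hg.form_noise]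
  exact integrable_finsetSum _ fun i _ => integrable_finsetSum _ fun j _ =>
    ((he i).integrable_mul (he j)).const_mul _

/-- Independence and zero mean remove the off-diagonal terms; each of the `n` diagonal ones is at
most `n⁻² L σ²`. -/
theorem integral_form_noise_le (hg : IsNormalSolution t α g) (hn : 0 < n)
    (he : ∀ i, MemLp (e i) 2 P) (hindep : iIndepFun e P) (hmean : ∀ i, ∫ ω, e i ω ∂P = 0)
    (hvar : ∀ i, Var[e i; P] ≤ σ ^ 2) {L : ℝ} (hL0 : 0 ≤ L)
    (hL : ∀ i x, inner ℝ (t i) x ^ 2 ≤ L * tikhonovForm t α x x) :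
    ∫ ω, tikhonovForm t α ((n : ℝ)⁻¹ • ∑ i, e i ω • g i)
      ((n : ℝ)⁻¹ • ∑ i, e i ω • g i) ∂P ≤ L * σ ^ 2 / n := by
  have hint : ∀ i j, Integrable (fun ω => (n : ℝ)⁻¹ ^ 2 * inner ℝ (t i) (g j) * (e i ω * e j ω)) P :=
    fun i j => ((he i).integrable_mul (he j)).const_mul _
  have hn' : (0 : ℝ) < n := by exact_mod_cast hn
  simp only [hg.form_noise]
  rw [integral_finsetSum _ fun i _ => integrable_finsetSum _ fun j _ => hint i j]
  calc _ ≤ ∑ _i : Fin n, (n : ℝ)⁻¹ ^ 2 * (L * σ ^ 2) := by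
        refine Finset.sum_le_sum fun i _ => ?_
        rw [integral_finsetSum _ fun j _ => hint i j, Finset.sum_eq_single i]
        · rw [integral_const_mul, mul_assoc]
          refine mul_le_mul_of_nonneg_left ?_ (by positivity)
          have hv : ∫ ω, e i ω * e i ω ∂P ≤ σ ^ 2 := by
            have := hvar i
            rw [variance_of_integral_eq_zero (he i).aemeasurable (hmean i)] at this
            simpa only [← sq] using this
          exact mul_le_mul (hg.inner_le i (hL i) hL0) hv
            (integral_nonneg fun ω => mul_self_nonneg _) hL0
        · intro j _ hji
          rw [integral_const_mul, (hindep.indepFun hji.symm).integral_fun_mul_eq_mul_integral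
            (he i).1 (he j).1, hmean i, zero_mul, mul_zero]
        · intro h
          exact absurd (Finset.mem_univ i) h
    _ = _ := by
        rw [Finset.sum_const, Finset.card_univ, Fintype.card_fin, nsmul_eq_mul]
        field_simp

/-- The expected error, measured by a continuous functional dominated by the energy. -/
theorem integral_error_le [IsProbabilityMeasure P] (hg : IsNormalSolution t α g) (hα : 0 ≤ α) (hn : 0 < n)
    (he : ∀ i, MemLp (e i) 2 P) (hindep : iIndepFun e P) (hmean : ∀ i, ∫ ω, e i ω ∂P = 0)
    (hvar : ∀ i, Var[e i; P] ≤ σ ^ 2) {L : ℝ} (hL0 : 0 ≤ L)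
    (hL : ∀ i x, inner ℝ (t i) x ^ 2 ≤ L * tikhonovForm t α x x) {Q : H → ℝ} (hQ : Continuous Q)
    (hQ0 : ∀ x, 0 ≤ Q x) {A : ℝ} (hA : 0 ≤ A) (hQA : ∀ x, Q x ≤ A * tikhonovForm t α x x) (x : H) :
    Integrable (fun ω => Q ((n : ℝ)⁻¹ • ∑ i, (inner ℝ (t i) x + e i ω) • g i - x)) P ∧
      ∫ ω, Q ((n : ℝ)⁻¹ • ∑ i, (inner ℝ (t i) x + e i ω) • g i - x) ∂P ≤
        2 * A * (α * ‖x‖ ^ 2 + L * σ ^ 2 / n) := by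
  have hb := hg.bias_le hα x
  have hI := hg.integrable_form_noise he
  have hN := hg.integral_form_noise_le hn he hindep hmean hvar hL0 hL
  have hsplit : ∀ ω, (n : ℝ)⁻¹ • ∑ i, (inner ℝ (t i) x + e i ω) • g i - x =
      ((n : ℝ)⁻¹ • ∑ i, inner ℝ (t i) x • g i - x) + (n : ℝ)⁻¹ • ∑ i, e i ω • g i := fun ω => by
    simp only [add_smul, Finset.sum_add_distrib, smul_add]
    abel
  have hle : ∀ ω, Q ((n : ℝ)⁻¹ • ∑ i, (inner ℝ (t i) x + e i ω) • g i - x) ≤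
      2 * A * (α * ‖x‖ ^ 2) + 2 * A * tikhonovForm t α ((n : ℝ)⁻¹ • ∑ i, e i ω • g i)
        ((n : ℝ)⁻¹ • ∑ i, e i ω • g i) := fun ω => by
    rw [hsplit]
    refine (hQA _).trans ?_
    have h1 := tikhonovForm_add_self_le t hα ((n : ℝ)⁻¹ • ∑ i, inner ℝ (t i) x • g i - x)
      ((n : ℝ)⁻¹ • ∑ i, e i ω • g i)
    have h2 := mul_le_mul_of_nonneg_left h1 hA
    have h3 := mul_le_mul_of_nonneg_left hb hA
    linarith
  have hdom : Integrable (fun ω => 2 * A * (α * ‖x‖ ^ 2) +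
      2 * A * tikhonovForm t α ((n : ℝ)⁻¹ • ∑ i, e i ω • g i)
        ((n : ℝ)⁻¹ • ∑ i, e i ω • g i)) P := (integrable_const _).add (hI.const_mul _)
  have hmeas : AEStronglyMeasurable
      (fun ω => (n : ℝ)⁻¹ • ∑ i, (inner ℝ (t i) x + e i ω) • g i - x) P := by
    refine AEStronglyMeasurable.sub (AEStronglyMeasurable.const_smul ?_ _)
      aestronglyMeasurable_const
    exact Finset.aestronglyMeasurable_fun_sum _ fun i _ =>
      (aestronglyMeasurable_const.add (he i).1).smul_const _
  have hint := hdom.mono' (hQ.comp_aestronglyMeasurable hmeas) (Eventually.of_forall fun ω => by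
    rw [Real.norm_of_nonneg (hQ0 _)]
    exact hle ω)
  refine ⟨hint, (integral_mono hint hdom hle).trans ?_⟩
  rw [integral_add (integrable_const _) (hI.const_mul _), integral_const,
    probReal_univ, one_smul, integral_const_mul]
  have := mul_le_mul_of_nonneg_left hN (by positivity : 0 ≤ 2 * A)
  linarith

end Noise

end IsNormalSolution

end TikhonovForm

/-! ### The dual norm in terms of a singular system. -/

namespace SingularSystem

variable {a b : ℝ} {K : L2 a b →L[ℝ] L2 a b} {ι : Type*}

theorem φ_mem (S : SingularSystem K ι) (j : ι) : S.φ j ∈ K.kerᗮ := by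
  rw [← S.φ_complete]
  exact Submodule.le_topologicalClosure _ (Submodule.subset_span ⟨j, rfl⟩)

theorem inner_map_ψ (S : SingularSystem K ι) (j : ι) (u : L2 a b) :
    inner ℝ (K u) (S.ψ j) = S.s j * inner ℝ u (S.φ j) := by
  rw [← ContinuousLinearMap.adjoint_inner_right, S.adjoint_map_ψ, inner_smul_right]

theorem s_le (S : SingularSystem K ι) (j : ι) : S.s j ≤ ‖K‖ := by
  have h := K.le_opNorm (S.φ j)
  rwa [S.map_φ, norm_smul, S.ψ_orthonormal.1, S.φ_orthonormal.1, mul_one, mul_one,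
    Real.norm_of_nonneg (S.s_pos j).le] at h

/-- Parseval's identity in `N(K)^⊥`. -/
theorem hasSum_inner_mul_inner (S : SingularSystem K ι) {u : L2 a b} (hu : u ∈ K.kerᗮ)
    (v : L2 a b) : HasSum (fun j => inner ℝ u (S.φ j) * inner ℝ v (S.φ j)) (inner ℝ u v) := by
  let φ' : ι → ↥K.kerᗮ := fun j => ⟨S.φ j, S.φ_mem j⟩
  have hφ' : Orthonormal ℝ φ' := by
    have := S.φ_orthonormal
    exact ⟨fun j => this.1 j, fun i j hij => this.2 hij⟩
  have hperp : (Submodule.span ℝ (Set.range φ'))ᗮ = ⊥ := by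
    rw [Submodule.eq_bot_iff]
    intro x hx
    have h1 : (x : L2 a b) ∈ (Submodule.span ℝ (Set.range S.φ))ᗮ := by
      rw [Submodule.mem_orthogonal]
      intro y hy
      refine Submodule.span_induction (p := fun y _ => inner ℝ y (x : L2 a b) = 0) ?_ ?_ ?_ ?_ hy
      · rintro _ ⟨j, rfl⟩
        exact (Submodule.mem_orthogonal _ _).1 hx (φ' j) (Submodule.subset_span ⟨j, rfl⟩)
      · exact inner_zero_left _
      · intro y z _ _ h1 h2
        rw [inner_add_left, h1, h2, add_zero]
      · intro c y _ h1
        rw [real_inner_smul_left, h1, mul_zero]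
    rw [← Submodule.orthogonal_closure, S.φ_complete] at h1
    have h2 := (Submodule.mem_orthogonal _ _).1 h1 x x.2
    exact Subtype.ext (inner_self_eq_zero.1 h2)
  let e := HilbertBasis.mkOfOrthogonalEqBot hφ' hperp
  have h := e.hasSum_inner_mul_inner ⟨u, hu⟩ (K.kerᗮ.orthogonalProjectionOnto v)
  simp only [e, HilbertBasis.coe_mkOfOrthogonalEqBot,
    Submodule.inner_orthogonalProjectionOnto_eq_of_mem_left] at h
  convert! h using 2 with j
  rw [real_inner_comm (S.φ j) v]
  rfl

/-- The quadratic form `∑ⱼ s_j u_j²`. -/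
noncomputable def weakSq (S : SingularSystem K ι) (u : L2 a b) : ℝ :=
  ∑' j, S.s j * inner ℝ u (S.φ j) ^ 2

theorem summable_sq (S : SingularSystem K ι) (u : L2 a b) :
    Summable fun j => inner ℝ u (S.φ j) ^ 2 := by
  simpa [real_inner_comm] using S.φ_orthonormal.inner_products_summable (x := u)

theorem tsum_sq_le (S : SingularSystem K ι) (u : L2 a b) :
    ∑' j, inner ℝ u (S.φ j) ^ 2 ≤ ‖u‖ ^ 2 := by
  simpa [real_inner_comm] using S.φ_orthonormal.tsum_inner_products_le (x := u)

theorem summable_weakSq (S : SingularSystem K ι) (u : L2 a b) :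
    Summable fun j => S.s j * inner ℝ u (S.φ j) ^ 2 :=
  ((S.summable_sq u).mul_left ‖K‖).of_nonneg_of_le
    (fun j => mul_nonneg (S.s_pos j).le (sq_nonneg _))
    (fun j => mul_le_mul_of_nonneg_right (S.s_le j) (sq_nonneg _))

theorem weakSq_nonneg (S : SingularSystem K ι) (u : L2 a b) : 0 ≤ S.weakSq u :=
  tsum_nonneg fun j => mul_nonneg (S.s_pos j).le (sq_nonneg _)

theorem weakSq_le_mul_norm_sq (S : SingularSystem K ι) (u : L2 a b) :
    S.weakSq u ≤ ‖K‖ * ‖u‖ ^ 2 := by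
  calc S.weakSq u ≤ ∑' j, ‖K‖ * inner ℝ u (S.φ j) ^ 2 :=
        (S.summable_weakSq u).tsum_le_tsum
          (fun j => mul_le_mul_of_nonneg_right (S.s_le j) (sq_nonneg _))
          ((S.summable_sq u).mul_left _)
    _ = ‖K‖ * ∑' j, inner ℝ u (S.φ j) ^ 2 := tsum_mul_left
    _ ≤ _ := mul_le_mul_of_nonneg_left (S.tsum_sq_le u) (norm_nonneg _)

/-- Termwise Young inequality `s ≤ (c⁻¹ s² + c) / 2`, followed by Bessel's inequality for both
orthonormal systems. -/
theorem weakSq_le (S : SingularSystem K ι) (u : L2 a b) {c : ℝ} (hc : 0 < c) :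
    S.weakSq u ≤ (c⁻¹ * ‖K u‖ ^ 2 + c * ‖u‖ ^ 2) / 2 := by
  have hs : Summable fun j => inner ℝ (K u) (S.ψ j) ^ 2 := by
    simpa [real_inner_comm] using S.ψ_orthonormal.inner_products_summable (x := K u)
  have ht : ∑' j, inner ℝ (K u) (S.ψ j) ^ 2 ≤ ‖K u‖ ^ 2 := by
    simpa [real_inner_comm] using S.ψ_orthonormal.tsum_inner_products_le (x := K u)
  calc S.weakSq u ≤ ∑' j, (c⁻¹ / 2 * inner ℝ (K u) (S.ψ j) ^ 2 + c / 2 * inner ℝ u (S.φ j) ^ 2) := by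
        refine (S.summable_weakSq u).tsum_le_tsum (fun j => ?_)
          ((hs.mul_left _).add ((S.summable_sq u).mul_left _))
        rw [S.inner_map_ψ]
        have h : 0 ≤ c⁻¹ / 2 * (S.s j * inner ℝ u (S.φ j) - c * inner ℝ u (S.φ j)) ^ 2 := by
          positivity
        have e : c⁻¹ / 2 * (S.s j * inner ℝ u (S.φ j) - c * inner ℝ u (S.φ j)) ^ 2 =
            c⁻¹ / 2 * (S.s j * inner ℝ u (S.φ j)) ^ 2 + c / 2 * inner ℝ u (S.φ j) ^ 2 -
              S.s j * inner ℝ u (S.φ j) ^ 2 := by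
          field_simp
          ring
        linarith
    _ = c⁻¹ / 2 * ∑' j, inner ℝ (K u) (S.ψ j) ^ 2 + c / 2 * ∑' j, inner ℝ u (S.φ j) ^ 2 := by
        rw [(hs.mul_left _).tsum_add ((S.summable_sq u).mul_left _), tsum_mul_left, tsum_mul_left]
    _ ≤ c⁻¹ / 2 * ‖K u‖ ^ 2 + c / 2 * ‖u‖ ^ 2 := by
        have := S.tsum_sq_le u
        gcongr
    _ = _ := by ring

/-- The form is the squared norm of the bounded map `u ↦ (√sⱼ uⱼ)` into `ℓ²`. Continuity yields
measurability of the random error. -/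
theorem continuous_weakSq (S : SingularSystem K ι) : Continuous S.weakSq := by
  have hsq : ∀ (u : L2 a b) j, ‖√(S.s j) * inner ℝ u (S.φ j)‖ ^ (2 : ENNReal).toReal =
      S.s j * inner ℝ u (S.φ j) ^ 2 := fun u j => by
    simp [mul_pow, Real.sq_sqrt (S.s_pos j).le]
  have hmem : ∀ u : L2 a b, Memℓp (fun j => √(S.s j) * inner ℝ u (S.φ j)) 2 := fun u => by
    refine memℓp_gen ?_
    simp only [hsq]
    exact S.summable_weakSq u
  let A : L2 a b →ₗ[ℝ] lp (fun _ : ι => ℝ) 2 :=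
    { toFun := fun u => ⟨_, hmem u⟩
      map_add' := fun u v => by
        ext j
        simp only [lp.coeFn_add, Pi.add_apply, inner_add_left, mul_add]
      map_smul' := fun c u => by
        ext j
        simp only [lp.coeFn_smul, Pi.smul_apply, real_inner_smul_left, RingHom.id_apply, smul_eq_mul]
        ring }
  have hA : ∀ u, ‖A u‖ ^ 2 = S.weakSq u := fun u => by
    have h := lp.norm_rpow_eq_tsum (p := 2) (by norm_num) (A u)
    simp only [A, LinearMap.coe_mk, AddHom.coe_mk, hsq] at h
    rw [weakSq, ← h]
    simp [A]
  let A' := A.mkContinuous √‖K‖ fun u => by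
    refine abs_le_of_sq_le_sq' ?_ (by positivity) |>.2
    rw [hA, mul_pow, Real.sq_sqrt (norm_nonneg _)]
    exact S.weakSq_le_mul_norm_sq u
  have : S.weakSq = fun u => ‖A' u‖ ^ 2 := funext fun u => (hA u).symm
  rw [this]
  fun_prop

theorem abs_inner_le (S : SingularSystem K ι) {u v : L2 a b} (hu : u ∈ K.kerᗮ) (hv : v ∈ S.W) :
    |inner ℝ u v| ≤ √(S.weakSq u) * S.normW v := by
  have hN : 0 ≤ ∑' j, inner ℝ v (S.φ j) ^ 2 / S.s j :=
    tsum_nonneg fun j => div_nonneg (sq_nonneg _) (S.s_pos j).le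
  rw [normW, ← Real.sqrt_mul (S.weakSq_nonneg u)]
  refine Real.abs_le_sqrt ?_
  refine le_of_tendsto ((S.hasSum_inner_mul_inner hu v).pow 2) (Eventually.of_forall fun F => ?_)
  refine (Finset.sum_sq_le_sum_mul_sum_of_sq_le_mul F
    (f := fun j => S.s j * inner ℝ u (S.φ j) ^ 2) (g := fun j => inner ℝ v (S.φ j) ^ 2 / S.s j)
    (fun j _ => mul_nonneg (S.s_pos j).le (sq_nonneg _))
    (fun j _ => div_nonneg (sq_nonneg _) (S.s_pos j).le) (fun j _ => ?_)).trans ?_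
  · have := (S.s_pos j).ne'
    refine le_of_eq ?_
    field_simp
  · refine mul_le_mul ?_ ?_ (Finset.sum_nonneg fun j _ => div_nonneg (sq_nonneg _) (S.s_pos j).le)
      (S.weakSq_nonneg u)
    · exact (S.summable_weakSq u).sum_le_tsum F fun j _ => mul_nonneg (S.s_pos j).le (sq_nonneg _)
    · exact hv.2.sum_le_tsum F fun j _ => div_nonneg (sq_nonneg _) (S.s_pos j).le

/-- The upper bound is weighted Cauchy–Schwarz. For the lower bound, the extremal candidate `∑ sⱼ uⱼ
φⱼ`, cut off to a finite set so that it lies in `W`, attains the square root of the partial sum. -/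
theorem normWDual_sq (S : SingularSystem K ι) {u : L2 a b} (hu : u ∈ K.kerᗮ) :
    S.normWDual u ^ 2 = S.weakSq u := by
  have hub : ∀ r ∈ {r | ∃ v ∈ S.W, v ≠ 0 ∧ r = |inner ℝ u v| / S.normW v}, r ≤ √(S.weakSq u) := by
    rintro _ ⟨v, hv, -, rfl⟩
    exact div_le_of_le_mul₀ (Real.sqrt_nonneg _) (Real.sqrt_nonneg _) (S.abs_inner_le hu hv)
  have h0 : 0 ≤ S.normWDual u := Real.sSup_nonneg (by
    rintro _ ⟨v, -, -, rfl⟩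
    exact div_nonneg (abs_nonneg _) (Real.sqrt_nonneg _))
  refine le_antisymm ?_ ?_
  · rw [← Real.sq_sqrt (S.weakSq_nonneg u)]
    exact pow_le_pow_left₀ h0 (Real.sSup_le hub (Real.sqrt_nonneg _)) 2
  · refine (S.summable_weakSq u).tsum_le_of_sum_le fun F => ?_
    set q := ∑ j ∈ F, S.s j * inner ℝ u (S.φ j) ^ 2 with hq
    have hq0 : 0 ≤ q := Finset.sum_nonneg fun j _ => mul_nonneg (S.s_pos j).le (sq_nonneg _)
    rcases hq0.eq_or_lt with hq1 | hq1
    · rw [← hq1]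
      positivity
    classical
    set v : L2 a b := ∑ j ∈ F, (S.s j * inner ℝ u (S.φ j)) • S.φ j with hv
    have hvj : ∀ j, inner ℝ v (S.φ j) = if j ∈ F then S.s j * inner ℝ u (S.φ j) else 0 := by
      intro j
      rw [hv, sum_inner]
      simp only [real_inner_smul_left, orthonormal_iff_ite.1 S.φ_orthonormal]
      simp
    have huv : inner ℝ u v = q := by
      rw [hv, inner_sum]
      refine Finset.sum_congr rfl fun j _ => ?_
      rw [inner_smul_right]
      ring
    have hvs : HasSum (fun j => inner ℝ v (S.φ j) ^ 2 / S.s j) q := by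
      have : q = ∑ j ∈ F, inner ℝ v (S.φ j) ^ 2 / S.s j := by
        refine Finset.sum_congr rfl fun j hj => ?_
        have := (S.s_pos j).ne'
        rw [hvj, if_pos hj]
        field_simp
      rw [this]
      exact hasSum_sum_of_ne_finset_zero fun j hj => by rw [hvj, if_neg hj]; simp
    have hvW : v ∈ S.W :=
      ⟨Submodule.sum_mem _ fun j _ => Submodule.smul_mem _ _ (S.φ_mem j), hvs.summable⟩
    have hv0 : v ≠ 0 := by
      intro h
      rw [h, inner_zero_right] at huv
      exact hq1.ne huv
    have hle : √q ≤ S.normWDual u := by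
      refine le_csSup ⟨_, hub⟩ ⟨v, hvW, hv0, ?_⟩
      rw [huv, normW, hvs.tsum_eq, abs_of_pos hq1, Real.div_sqrt]
    calc q = √q ^ 2 := (Real.sq_sqrt hq0).symm
      _ ≤ _ := pow_le_pow_left₀ (Real.sqrt_nonneg _) hle 2

theorem hasSum_normWDual_sq (S : SingularSystem K ι) {u : L2 a b} (hu : u ∈ K.kerᗮ) :
    HasSum (fun j => S.s j * inner ℝ u (S.φ j) ^ 2) (S.normWDual u ^ 2) := by
  rw [S.normWDual_sq hu]
  exact (S.summable_weakSq u).hasSum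

end SingularSystem

variable {a b : ℝ} {m : ℕ} {K : L2 a b →L[ℝ] L2 a b}

/-! ### Compactness from the sampling inequality. -/

section Compactness

theorem exists_finite_net (a b : ℝ) {h : ℝ} (hh : 0 < h) :
    ∃ (n : ℕ) (pts : Fin n → ℝ), (∀ i, pts i ∈ Icc a b) ∧ ∀ s ∈ Icc a b, ∃ i, |s - pts i| ≤ h := by
  obtain ⟨T, hT, hTf, hcov⟩ := (isCompact_Icc (a := a) (b := b)).finite_cover_balls hh
  lift T to Finset ℝ using hTf
  refine ⟨T.card, fun i => T.equivFin.symm i, fun i => hT (T.equivFin.symm i).2, fun s hs => ?_⟩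
  obtain ⟨x, hx, hsx⟩ := mem_iUnion₂.1 (hcov hs)
  refine ⟨T.equivFin ⟨x, hx⟩, ?_⟩
  simp only [Equiv.symm_apply_apply, ← Real.dist_eq]
  exact (Metric.mem_ball.1 hsx).le

/-- An operator with range in `H^m` is compact. -/
theorem isCompactOperator_of_range (hab : a < b) (hm : 0 < m)
    (hrange : ∀ x, MemSobolev a b m (K x)) : IsCompactOperator K := by
  obtain ⟨C, hC, H⟩ := exists_norm_sq_le_sampling hab hm hrange
  have key : K ∈ closure {f : L2 a b →L[ℝ] L2 a b | IsCompactOperator f} := by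
    rw [Metric.mem_closure_iff]
    intro ε hε
    obtain ⟨h, hh, hhε⟩ : ∃ h : ℝ, 0 < h ∧ √C * h ^ m < ε := by
      have ht : Tendsto (fun h : ℝ => √C * h ^ m) (𝓝[>] 0) (𝓝 0) := by
        have : Continuous fun h : ℝ => √C * h ^ m := by fun_prop
        have h0 := this.tendsto 0
        rw [zero_pow hm.ne', mul_zero] at h0
        exact h0.mono_left nhdsWithin_le_nhds
      obtain ⟨h, h1, h2⟩ := ((ht.eventually (gt_mem_nhds hε)).and self_mem_nhdsWithin).exists
      exact ⟨h, h2, h1⟩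
    obtain ⟨n, pts, hpts, hcov⟩ := exists_finite_net a b hh
    choose t ht using fun i => exists_inner_eq_pointValue hab hm hrange (hpts i)
    let V : Submodule ℝ (L2 a b) := Submodule.span ℝ (Set.range t)
    have : FiniteDimensional ℝ V := FiniteDimensional.span_of_finite ℝ (Set.finite_range t)
    -- Orthogonally to the representers all samples of `K x` vanish, so the sampling inequality
    -- leaves only `√C h^m ‖x‖` for the distance to this finite-rank operator.
    refine ⟨K ∘L V.starProjection, ?_, ?_⟩
    · have h1 : IsCompactOperator (_root_.id : V → V) :=
        isCompactOperator_id_iff_finiteDimensional (𝕜 := ℝ) |>.2 this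
      exact (h1.clm_comp (K ∘L V.subtypeL)).comp_clm V.orthogonalProjectionOnto
    · rw [dist_eq_norm]
      refine (ContinuousLinearMap.opNorm_le_bound _ (by positivity) fun x => ?_).trans_lt hhε
      have hx : (K - K ∘L V.starProjection) x = K (Vᗮ.starProjection x) := by
        have e := V.starProjection_add_starProjection_orthogonal x
        rw [_root_.sub_apply, ContinuousLinearMap.comp_apply, ← map_sub]
        congr 1
        rw [sub_eq_iff_eq_add, add_comm]
        exact e.symm
      rw [hx]
      have hz := H n pts h hh hcov (Vᗮ.starProjection x)
      have h0 : ∀ i, pointValue (K (Vᗮ.starProjection x)) (pts i) = 0 := fun i => by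
        rw [← ht i]
        exact (Submodule.mem_orthogonal _ _).1 (Vᗮ.starProjection_apply_mem x) _
          (Submodule.subset_span ⟨i, rfl⟩)
      simp only [h0, ne_eq, OfNat.ofNat_ne_zero, not_false_eq_true, zero_pow,
        Finset.sum_const_zero, mul_zero, zero_add] at hz
      refine abs_le_of_sq_le_sq' ?_ (by positivity) |>.2
      rw [mul_pow, mul_pow, Real.sq_sqrt hC.le]
      refine hz.trans ?_
      rw [← pow_mul, mul_comm m 2, mul_assoc]
      have := Vᗮ.norm_starProjection_apply_le x
      gcongr
  have hcl := isClosed_setOfPred_isCompactOperator (σ₁₂ := RingHom.id ℝ) (M₁ := L2 a b)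
    (M₂ := L2 a b)
  have h2 := hcl.closure_subset key
  exact h2

end Compactness

/-! ### Singular systems from the spectral theorem for `K* K`. -/

section Existence

open Module.End

/-- A compact operator has a singular system. -/
theorem exists_singularSystem (hK : IsCompactOperator K) :
    ∃ ι : Type, Nonempty (SingularSystem K ι) := by
  set T : L2 a b →L[ℝ] L2 a b := ContinuousLinearMap.adjoint K ∘L K with hTdef
  have hT : IsCompactOperator T := hK.clm_comp (ContinuousLinearMap.adjoint K)
  have hinner : ∀ x y, inner ℝ (T x) y = inner ℝ (K x) (K y) := fun x y => by
    rw [hTdef, ContinuousLinearMap.comp_apply, ContinuousLinearMap.adjoint_inner_left]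
  have hsymm : (T : L2 a b →ₗ[ℝ] L2 a b).IsSymmetric := fun x y => by
    change inner ℝ (T x) y = inner ℝ x (T y)
    rw [hinner, real_inner_comm, ← hinner, real_inner_comm]
  let E : ℝ → Submodule ℝ (L2 a b) := fun μ => eigenspace (T : Module.End ℝ (L2 a b)) μ
  have hfin : ∀ μ : {μ : ℝ // μ ≠ 0}, FiniteDimensional ℝ (E μ) := fun μ =>
    ContinuousLinearMap.finite_dimensional_eigenspace hT μ μ.2
  -- Nonzero eigenvalues have finite multiplicity; an index is such an eigenvalue with a position in
  -- an orthonormal basis of its eigenspace.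
  let ι : Type := Σ μ : {μ : ℝ // μ ≠ 0}, Fin (Module.finrank ℝ (E μ))
  let φ : ι → L2 a b := fun j => (stdOrthonormalBasis ℝ (E j.1) j.2 : L2 a b)
  have hφE : ∀ j, φ j ∈ E j.1 := fun j => Subtype.mem _
  have hTφ : ∀ j, T (φ j) = (j.1 : ℝ) • φ j := fun j => mem_eigenspace_iff.1 (hφE j)
  have hφ : Orthonormal ℝ φ := by
    have h1 : OrthogonalFamily ℝ (fun μ : {μ : ℝ // μ ≠ 0} => E μ) fun μ => (E μ).subtypeₗᵢ :=
      hsymm.orthogonalFamily_eigenspaces.comp Subtype.val_injective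
    exact h1.orthonormal_sigma_orthonormal
      (v_family := fun μ => stdOrthonormalBasis ℝ (E μ)) fun μ => OrthonormalBasis.orthonormal _
  have hKK : ∀ i j, inner ℝ (K (φ i)) (K (φ j)) = (i.1 : ℝ) * inner ℝ (φ i) (φ j) := fun i j => by
    rw [← hinner, hTφ, real_inner_smul_left]
  have hpos : ∀ j : ι, 0 < (j.1 : ℝ) := fun j => by
    have h1 := hKK j j
    rw [real_inner_self_eq_norm_sq, real_inner_self_eq_norm_sq, hφ.1 j, one_pow, mul_one] at h1
    exact lt_of_le_of_ne (h1 ▸ sq_nonneg _) j.1.2.symm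
  have hspos : ∀ j : ι, 0 < √(j.1 : ℝ) := fun j => Real.sqrt_pos.2 (hpos j)
  have hker : ∀ x, T x = 0 → K x = 0 := fun x hx => by
    have := hinner x x
    rw [hx, inner_zero_left] at this
    exact inner_self_eq_zero.1 this.symm
  have hφker : ∀ j, φ j ∈ K.kerᗮ := fun j => by
    rw [Submodule.mem_orthogonal']
    intro z hz
    have hz' : K z = 0 := hz
    have h1 := hinner (φ j) z
    rw [hz', inner_zero_right, hTφ, real_inner_smul_left] at h1
    exact (mul_eq_zero.1 h1).resolve_left j.1.2
  have hclosed : IsClosed (K.ker : Set (L2 a b)) := K.isClosed_ker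
  have : CompleteSpace K.ker := hclosed.completeSpace_coe
  refine ⟨ι, ⟨⟨fun j => √(j.1 : ℝ), φ, fun j => (√(j.1 : ℝ))⁻¹ • K (φ j), hspos, hφ, ?_,
    fun j => ?_, fun j => ?_, ?_⟩⟩⟩
  · classical
    rw [orthonormal_iff_ite] at hφ ⊢
    intro i j
    rw [real_inner_smul_left, inner_smul_right, hKK, hφ i j]
    split_ifs with hij
    · subst hij
      have h1 := (hspos i).ne'
      have h2 := Real.sq_sqrt (hpos i).le
      field_simp
      linarith
    · simp
  · rw [smul_smul, mul_inv_cancel₀ (hspos j).ne', one_smul]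
  · rw [map_smul]
    change _ • T (φ j) = _
    rw [hTφ, smul_smul]
    congr 1
    have h1 := (hspos j).ne'
    have h2 := Real.sq_sqrt (hpos j).le
    field_simp
    linarith
  · set U := (Submodule.span ℝ (Set.range φ)).topologicalClosure with hU
    refine le_antisymm ?_ ?_
    · refine Submodule.topologicalClosure_minimal _ ?_ (Submodule.isClosed_orthogonal _)
      rw [Submodule.span_le]
      rintro _ ⟨j, rfl⟩
      exact hφker j
    · have hperp : Uᗮ ≤ K.ker := by
        intro x hx
        set q := K.kerᗮ.starProjection x with hq
        set p := K.ker.starProjection x with hp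
        have hpq : p + q = x := K.ker.starProjection_add_starProjection_orthogonal x
        have hpm : p ∈ K.ker := K.ker.starProjection_apply_mem x
        have hqm : q ∈ K.kerᗮ := K.kerᗮ.starProjection_apply_mem x
        have hqφ : ∀ j, inner ℝ (φ j) q = 0 := fun j => by
          have h1 : inner ℝ (φ j) x = 0 := (Submodule.mem_orthogonal _ _).1 hx _
            (Submodule.le_topologicalClosure _ (Submodule.subset_span ⟨j, rfl⟩))
          have h2 : inner ℝ (φ j) p = 0 := (Submodule.mem_orthogonal' _ _).1 (hφker j) p hpm
          rw [← hpq, inner_add_right, h2, zero_add] at h1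
          exact h1
        have hq0 : q ∈ (⨆ μ, eigenspace (T : Module.End ℝ (L2 a b)) μ)ᗮ := by
          rw [Submodule.mem_orthogonal']
          intro z hz
          have hle : (⨆ μ, eigenspace (T : Module.End ℝ (L2 a b)) μ) ≤ (Submodule.span ℝ {q})ᗮ := by
            refine iSup_le fun μ z hz => ?_
            rw [Submodule.mem_orthogonal_singleton_iff_inner_right]
            by_cases hμ : μ = 0
            · subst hμ
              have h1 : T z = (0 : ℝ) • z := mem_eigenspace_iff.1 hz
              rw [zero_smul] at h1
              exact (Submodule.mem_orthogonal' _ _).1 hqm z (hker z h1)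
            · have := hfin ⟨μ, hμ⟩
              have h1 := (stdOrthonormalBasis ℝ (E μ)).sum_repr ⟨z, hz⟩
              have h2 := congrArg (Subtype.val) h1
              rw [Submodule.coe_sum] at h2
              simp only [Submodule.coe_smul] at h2
              rw [← h2, inner_sum]
              refine Finset.sum_eq_zero fun i _ => ?_
              rw [inner_smul_right, real_inner_comm]
              exact mul_eq_zero_of_right _ (hqφ ⟨⟨μ, hμ⟩, i⟩)
          exact (Submodule.mem_orthogonal_singleton_iff_inner_right).1 (hle hz)
        rw [ContinuousLinearMap.orthogonalComplement_iSup_eigenspaces_eq_bot hT hsymm] at hq0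
        rw [(Submodule.mem_bot ℝ).1 hq0, add_zero] at hpq
        rw [← hpq]
        exact hpm
      have h1 := Submodule.orthogonal_le hperp
      have hUc : CompleteSpace U :=
        (Submodule.isClosed_topologicalClosure _).completeSpace_coe
      rwa [Submodule.orthogonal_orthogonal] at h1

end Existence

/-! ### Mesh size and the number of sampling points. -/

section Mesh

variable {a b : ℝ} {n : ℕ} {pts : Fin n → ℝ}

theorem iInf_abs_sub_le (i : Fin n) (s : ℝ) : ⨅ j, |s - pts j| ≤ |s - pts i| :=
  ciInf_le ⟨0, by rintro _ ⟨j, rfl⟩; exact abs_nonneg _⟩ i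

theorem iInf_abs_sub_le_length (hn : 0 < n) (hpts : ∀ i, pts i ∈ Icc a b) {s : ℝ}
    (hs : s ∈ Icc a b) : ⨅ j, |s - pts j| ≤ b - a := by
  refine (iInf_abs_sub_le ⟨0, hn⟩ s).trans (abs_le.2 ⟨?_, ?_⟩) <;>
    linarith [hs.1, hs.2, (hpts ⟨0, hn⟩).1, (hpts ⟨0, hn⟩).2]

theorem iInf_abs_sub_le_meshSize (hn : 0 < n) (hpts : ∀ i, pts i ∈ Icc a b) {s : ℝ}
    (hs : s ∈ Icc a b) : ⨅ j, |s - pts j| ≤ meshSize a b pts :=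
  le_ciSup (f := fun x : Icc a b => ⨅ i, |(x : ℝ) - pts i|) ⟨b - a, by
    rintro _ ⟨x, rfl⟩
    exact iInf_abs_sub_le_length hn hpts x.2⟩ ⟨s, hs⟩

theorem exists_abs_sub_le_meshSize (hn : 0 < n) (hpts : ∀ i, pts i ∈ Icc a b) {s : ℝ}
    (hs : s ∈ Icc a b) : ∃ i, |s - pts i| ≤ meshSize a b pts := by
  have : Nonempty (Fin n) := ⟨⟨0, hn⟩⟩
  obtain ⟨i, hi⟩ := exists_eq_ciInf_of_finite (f := fun j => |s - pts j|)
  exact ⟨i, hi.trans_le (iInf_abs_sub_le_meshSize hn hpts hs)⟩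

theorem meshSize_le (hab : a < b) (hn : 0 < n) (hpts : ∀ i, pts i ∈ Icc a b) :
    meshSize a b pts ≤ b - a := by
  have : Nonempty (Icc a b) := ⟨⟨a, le_rfl, hab.le⟩⟩
  exact ciSup_le fun x => iInf_abs_sub_le_length hn hpts x.2

theorem meshSize_pos (hab : a < b) (hn : 0 < n) (hpts : ∀ i, pts i ∈ Icc a b) :
    0 < meshSize a b pts := by
  obtain ⟨s, hs, hs'⟩ := ((Icc_infinite hab).sdiff (Set.finite_range pts)).nonempty
  have : Nonempty (Fin n) := ⟨⟨0, hn⟩⟩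
  obtain ⟨i, hi⟩ := exists_eq_ciInf_of_finite (f := fun j => |s - pts j|)
  refine lt_of_lt_of_le ?_ (iInf_abs_sub_le_meshSize hn hpts hs)
  rw [← hi]
  exact abs_pos.2 (sub_ne_zero.2 fun h => hs' ⟨i, h.symm⟩)

/-- Quasi-uniform sampling points are not too many. -/
theorem meshSize_mul_card_le (hab : a < b) (hn : 0 < n) (hpts : ∀ i, pts i ∈ Icc a b)
    (hmono : StrictMono pts) {B : ℝ}
    (hB : ∀ i j, i ≠ j → meshSize a b pts ≤ B * |pts i - pts j|) :
    meshSize a b pts * n ≤ (|B| + 1) * (b - a) := by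
  set h := meshSize a b pts
  have hle := meshSize_le hab hn hpts
  -- Each gap is at least `h / |B|` in the form `h ≤ |B| · gap`; the gaps telescope. Only `n - 1`
  -- gaps occur, and `h ≤ b - a` pays for the missing one.
  have key : ∀ i (hi : i < n), h * i ≤ |B| * (pts ⟨i, hi⟩ - pts ⟨0, hn⟩) := by
    intro i
    induction i with
    | zero => intro hi; simp
    | succ i ih =>
      intro hi
      have h1 := ih (by omega)
      have hlt : pts ⟨i, by omega⟩ < pts ⟨i + 1, hi⟩ := hmono (by simp)
      have h2 := hB ⟨i + 1, hi⟩ ⟨i, by omega⟩ (by simp)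
      rw [abs_of_pos (sub_pos.2 hlt)] at h2
      have h3 := mul_le_mul_of_nonneg_right (le_abs_self B) (sub_pos.2 hlt).le
      push_cast
      linarith
  have h1 := key (n - 1) (by omega)
  have h2 : pts ⟨n - 1, by omega⟩ - pts ⟨0, hn⟩ ≤ b - a := by
    linarith [(hpts ⟨n - 1, by omega⟩).2, (hpts ⟨0, hn⟩).1]
  have h3 := mul_le_mul_of_nonneg_left h2 (abs_nonneg B)
  rw [Nat.cast_sub (by omega), Nat.cast_one] at h1
  linarith

end Mesh

/-! ### Best-approximate solutions for data in the range. -/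

section BestApprox

variable {a b : ℝ} {K : L2 a b →L[ℝ] L2 a b}

theorem IsBestApproxSolution.map_eq {y x : L2 a b} (h : IsBestApproxSolution K y x)
    (hy : y ∈ Set.range K) : K x = y := by
  obtain ⟨z, rfl⟩ := hy
  have := h.1 z
  rw [sub_self, norm_zero] at this
  exact sub_eq_zero.1 (norm_le_zero_iff.1 this)

/-- Removing the component in the kernel keeps the residual and, by Pythagoras, shortens the vector
unless that component is zero. -/
theorem IsBestApproxSolution.mem_ker_orthogonal {y x : L2 a b} (h : IsBestApproxSolution K y x) :
    x ∈ K.kerᗮ := by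
  have : CompleteSpace K.ker := K.isClosed_ker.completeSpace_coe
  set p := K.ker.starProjection x with hp
  set q := K.kerᗮ.starProjection x with hq
  have hpq : p + q = x := K.ker.starProjection_add_starProjection_orthogonal x
  have hpm : p ∈ K.ker := K.ker.starProjection_apply_mem x
  have hqm : q ∈ K.kerᗮ := K.kerᗮ.starProjection_apply_mem x
  have hKp : K p = 0 := hpm
  have hKq : K q = K x := by rw [← hpq, map_add, hKp, zero_add]
  have hle := h.2 q fun z => by rw [hKq]; exact h.1 z
  have hpyth : ‖x‖ * ‖x‖ = ‖p‖ * ‖p‖ + ‖q‖ * ‖q‖ := by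
    rw [← hpq]
    exact norm_add_sq_eq_norm_sq_add_norm_sq_of_inner_eq_zero _ _
      ((Submodule.mem_orthogonal _ _).1 hqm p hpm)
  have hp0 : p = 0 := by
    have h1 : ‖x‖ * ‖x‖ ≤ ‖q‖ * ‖q‖ := mul_self_le_mul_self (norm_nonneg _) hle
    have h2 : ‖p‖ * ‖p‖ = 0 := le_antisymm (by linarith) (mul_self_nonneg _)
    exact norm_eq_zero.1 (mul_self_eq_zero.1 h2)
  rw [← hpq, hp0, zero_add]
  exact hqm

end BestApprox

/-! ### The minimizer of the sampled functional. -/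

section Minimizer

variable {a b : ℝ} {K : L2 a b →L[ℝ] L2 a b} {n : ℕ} {pts : Fin n → ℝ} {t g : Fin n → L2 a b}
  {α : ℝ}

theorem isTikhonovMinimizer_iff (ht : ∀ i x, inner ℝ (t i) x = pointValue (K x) (pts i))
    (hα : 0 < α) (hg : IsNormalSolution t α g) (w : Fin n → ℝ) (x : L2 a b) :
    IsTikhonovMinimizer K pts w α x ↔ x = (n : ℝ)⁻¹ • ∑ i, w i • g i := by
  obtain ⟨c, hJ⟩ : ∃ c, ∀ x, tikhonov K pts w α x =
      tikhonovForm t α (x - (n : ℝ)⁻¹ • ∑ i, w i • g i) (x - (n : ℝ)⁻¹ • ∑ i, w i • g i) + c := by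
    refine ⟨(n : ℝ)⁻¹ * ∑ i, w i ^ 2 - tikhonovForm t α ((n : ℝ)⁻¹ • ∑ i, w i • g i)
      ((n : ℝ)⁻¹ • ∑ i, w i • g i), fun x => ?_⟩
    rw [tikhonov, one_div]
    simp only [← ht]
    exact hg.functional_eq w x
  constructor
  · intro h
    have h1 := h ((n : ℝ)⁻¹ • ∑ i, w i • g i)
    rw [hJ, hJ, sub_self, map_zero, add_le_add_iff_right] at h1
    have h2 := (mul_norm_sq_le_tikhonovForm t α _).trans h1
    have h3 := nonpos_of_mul_nonpos_right h2 hα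
    exact sub_eq_zero.1 (norm_eq_zero.1 (pow_eq_zero_iff (two_ne_zero) |>.1
      (le_antisymm h3 (sq_nonneg _))))
  · rintro rfl z
    rw [hJ, hJ, sub_self, map_zero, add_le_add_iff_right]
    exact tikhonovForm_self_nonneg t hα.le _

theorem existsUnique_isTikhonovMinimizer
    (ht : ∀ i x, inner ℝ (t i) x = pointValue (K x) (pts i)) (hα : 0 < α) (w : Fin n → ℝ) :
    ∃! x, IsTikhonovMinimizer K pts w α x := by
  obtain ⟨g, hg⟩ := exists_isNormalSolution t hα
  exact ⟨_, (isTikhonovMinimizer_iff ht hα hg w _).2 rfl,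
    fun x hx => (isTikhonovMinimizer_iff ht hα hg w x).1 hx⟩

theorem regularizedSolution_eq (ht : ∀ i x, inner ℝ (t i) x = pointValue (K x) (pts i))
    (hα : 0 < α) (hg : IsNormalSolution t α g) (w : Fin n → ℝ) :
    regularizedSolution K pts w α = (n : ℝ)⁻¹ • ∑ i, w i • g i := by
  rw [← isTikhonovMinimizer_iff ht hα hg w]
  exact Classical.epsilon_spec (existsUnique_isTikhonovMinimizer ht hα w).exists

end Minimizer

/-! ### The expected error of the regularized solution. -/

namespace NoisySampling

variable {a b B σ : ℝ} {m : ℕ} {K : L2 a b →L[ℝ] L2 a b}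

theorem h_pos (hab : a < b) (D : NoisySampling a b B σ) : 0 < D.h :=
  meshSize_pos hab D.n_pos D.pts_mem

theorem alpha_pos (hab : a < b) (D : NoisySampling a b B σ) {α : ℝ} (hα : D.h ^ (2 * m) ≤ α) :
    0 < α :=
  (pow_pos (D.h_pos hab) _).trans_le hα

theorem exists_functionals (hab : a < b) (hm : 0 < m) (hrange : ∀ x, MemSobolev a b m (K x))
    (D : NoisySampling a b B σ) :
    ∃ t : Fin D.n → L2 a b, ∀ i x, inner ℝ (t i) x = pointValue (K x) (D.pts i) := by
  choose t ht using fun i => exists_inner_eq_pointValue hab hm hrange (D.pts_mem i)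
  exact ⟨t, ht⟩

theorem solution_sub_mem (hab : a < b) (hm : 0 < m) (hrange : ∀ x, MemSobolev a b m (K x))
    {y x : L2 a b} (hx : IsBestApproxSolution K y x) (D : NoisySampling a b B σ) {α : ℝ}
    (hα : D.h ^ (2 * m) ≤ α) (ω : D.Ω) : D.solution K y α ω - x ∈ K.kerᗮ := by
  obtain ⟨t, ht⟩ := D.exists_functionals hab hm hrange
  have hα0 := D.alpha_pos hab hα
  obtain ⟨g, hg⟩ := exists_isNormalSolution t hα0
  refine Submodule.sub_mem _ ?_ hx.mem_ker_orthogonal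
  rw [solution, regularizedSolution_eq ht hα0 hg]
  refine Submodule.smul_mem _ _ (Submodule.sum_mem _ fun i _ => Submodule.smul_mem _ _ ?_)
  rw [Submodule.mem_orthogonal']
  intro z hz
  have hz' : K z = 0 := hz
  refine hg.inner_eq_zero hα0.ne' (fun j => ?_) i
  -- The representer supplies the vanishing of the point value of the zero class.
  have h0 := ht j 0
  rw [ht, hz', ← map_zero K, ← h0, inner_zero_right]

/-- Quasi-uniformity bounds `h n`, which turns the weight `h` of the sampling inequality into `n⁻¹`;
the remainder `h^(2m) ‖x‖²` is absorbed by `α ‖x‖²`. -/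
theorem exists_norm_sq_le_form (hab : a < b) (hm : 0 < m)
    (hrange : ∀ x, MemSobolev a b m (K x)) (B : ℝ) :
    ∃ C : ℝ, 0 < C ∧ ∀ (σ : ℝ) (D : NoisySampling a b B σ) (α : ℝ), D.h ^ (2 * m) ≤ α →
      ∀ t : Fin D.n → L2 a b, (∀ i x, inner ℝ (t i) x = pointValue (K x) (D.pts i)) →
      ∀ x, ‖K x‖ ^ 2 ≤ C * tikhonovForm t α x x := by
  obtain ⟨C, hC, H⟩ := exists_norm_sq_le_sampling hab hm hrange
  have hL : 0 < b - a := sub_pos.2 hab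
  refine ⟨C * ((|B| + 1) * (b - a) + 1), by positivity, fun σ D α hα t ht x => ?_⟩
  have hα0 := D.alpha_pos hab hα
  have hn : (0 : ℝ) < D.n := by exact_mod_cast D.n_pos
  have h1 := H D.n D.pts D.h (D.h_pos hab)
    (fun s hs => exists_abs_sub_le_meshSize D.n_pos D.pts_mem hs) x
  have h2 := meshSize_mul_card_le hab D.n_pos D.pts_mem D.pts_strictMono D.quasiUniform
  simp only [← ht] at h1
  have h3 := sum_sq_le_tikhonovForm t hα0.le x
  have h4 := mul_norm_sq_le_tikhonovForm t α x
  have hE := tikhonovForm_self_nonneg t hα0.le x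
  rw [mul_assoc]
  refine h1.trans (mul_le_mul_of_nonneg_left ?_ hC.le)
  set S := ∑ i, inner ℝ (t i) x ^ 2
  have hS : 0 ≤ (D.n : ℝ)⁻¹ * S :=
    mul_nonneg (by positivity) (Finset.sum_nonneg fun _ _ => sq_nonneg _)
  calc D.h * S + D.h ^ (2 * m) * ‖x‖ ^ 2 = D.h * D.n * ((D.n : ℝ)⁻¹ * S) + D.h ^ (2 * m) * ‖x‖ ^ 2 := by
        field_simp
    _ ≤ (|B| + 1) * (b - a) * ((D.n : ℝ)⁻¹ * S) + α * ‖x‖ ^ 2 := by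
        refine add_le_add (mul_le_mul_of_nonneg_right h2 hS) ?_
        gcongr
    _ ≤ (|B| + 1) * (b - a) * tikhonovForm t α x x + tikhonovForm t α x x := by gcongr
    _ = _ := by ring

/-- The error bound in expectation. -/
theorem exists_error_bound (hab : a < b) (hm : 0 < m) (hrange : ∀ x, MemSobolev a b m (K x))
    (B : ℝ) :
    ∃ C : ℝ, 0 < C ∧ ∀ (ι : Type*) (S : SingularSystem K ι) (y xdag : L2 a b),
      y ∈ Set.range K → IsBestApproxSolution K y xdag →
      ∀ (σ : ℝ) (D : NoisySampling a b B σ) (α : ℝ), D.h ^ (2 * m) ≤ α →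
        (∀ ω, D.solution K y α ω - xdag ∈ K.kerᗮ) ∧
        Integrable (fun ω => S.normWDual (D.solution K y α ω - xdag) ^ 2) D.P ∧
        ∫ ω, S.normWDual (D.solution K y α ω - xdag) ^ 2 ∂D.P ≤
          C * α ^ (1 / 2 : ℝ) * ‖xdag‖ ^ 2 +
            C * σ ^ 2 / (D.n * α ^ (1 / 2 + 1 / (2 * m) : ℝ)) := by
  obtain ⟨C, hC, H⟩ := exists_norm_sq_le_form hab hm hrange B
  obtain ⟨C₁, hC₁, H₁⟩ := exists_pointValue_sq_le hab hm hrange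
  refine ⟨(C + 1) + (C + 1) ^ 2 * C₁, by positivity, ?_⟩
  intro ι S y xdag hy hx σ D α hα
  have hmem := D.solution_sub_mem hab hm hrange hx hα
  have hα0 := D.alpha_pos hab hα
  have hn : (0 : ℝ) < D.n := by exact_mod_cast D.n_pos
  have hm0 : (0 : ℝ) < m := by exact_mod_cast hm
  obtain ⟨t, ht⟩ := D.exists_functionals hab hm hrange
  obtain ⟨g, hg⟩ := exists_isNormalSolution t hα0
  have HK := H σ D α hα t ht
  -- The scale at which `δ^(2m) ‖x‖²` is exactly the penalty term.
  set δ : ℝ := α ^ (1 / (2 * m) : ℝ) with hδ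
  have hδ0 : 0 < δ := Real.rpow_pos_of_pos hα0 _
  have hδα : δ ^ (2 * m) = α := by
    rw [hδ, ← Real.rpow_natCast, ← Real.rpow_mul hα0.le]
    push_cast
    rw [one_div, inv_mul_cancel₀ (by positivity), Real.rpow_one]
  -- With `c² = α`, both terms of `weakSq_le` are `c⁻¹` times quantities bounded by the energy.
  set c : ℝ := α ^ (1 / 2 : ℝ) with hc
  have hc0 : 0 < c := Real.rpow_pos_of_pos hα0 _
  have hcα : c * c = α := by
    rw [hc, ← Real.rpow_add hα0]
    norm_num
  have hL : ∀ i x, inner ℝ (t i) x ^ 2 ≤ C₁ * (C + 1) * δ⁻¹ * tikhonovForm t α x x := by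
    intro i x
    have h1 := H₁ (D.pts i) (D.pts_mem i) δ hδ0 x
    rw [← ht, hδα] at h1
    refine h1.trans ?_
    calc _ ≤ C₁ * δ⁻¹ * (C * tikhonovForm t α x x + tikhonovForm t α x x) :=
          mul_le_mul_of_nonneg_left (add_le_add (HK x) (mul_norm_sq_le_tikhonovForm t α x))
            (by positivity)
      _ = _ := by ring
  have hA : ∀ x, S.weakSq x ≤ (C + 1) / 2 * c⁻¹ * tikhonovForm t α x x := by
    intro x
    refine (S.weakSq_le x hc0).trans ?_
    have h1 := mul_norm_sq_le_tikhonovForm t α x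
    have h2 : c * ‖x‖ ^ 2 = c⁻¹ * (α * ‖x‖ ^ 2) := by
      rw [← hcα]
      field_simp
    rw [h2]
    calc _ ≤ (c⁻¹ * (C * tikhonovForm t α x x) + c⁻¹ * tikhonovForm t α x x) / 2 := by
          have := HK x
          gcongr
      _ = _ := by ring
  have hsol : ∀ ω, D.solution K y α ω - xdag =
      (D.n : ℝ)⁻¹ • ∑ i, (inner ℝ (t i) xdag + D.e i ω) • g i - xdag := fun ω => by
    rw [solution, regularizedSolution_eq ht hα0 hg]
    simp only [data, ht, hx.map_eq hy]
  have hnorm : ∀ ω, S.normWDual (D.solution K y α ω - xdag) ^ 2 =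
      S.weakSq ((D.n : ℝ)⁻¹ • ∑ i, (inner ℝ (t i) xdag + D.e i ω) • g i - xdag) := fun ω => by
    rw [S.normWDual_sq (hmem ω), hsol]
  obtain ⟨h1, h2⟩ := hg.integral_error_le hα0.le D.n_pos D.e_memLp D.e_indep D.e_mean D.e_var
    (by positivity) hL S.continuous_weakSq S.weakSq_nonneg (by positivity) hA xdag
  refine ⟨hmem, ?_, ?_⟩
  · simp only [hnorm]
    exact h1
  · simp only [hnorm]
    refine h2.trans ?_
    have hpow : α ^ (1 / 2 + 1 / (2 * m) : ℝ) = c * δ := Real.rpow_add hα0 _ _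
    rw [hpow]
    have e : 2 * ((C + 1) / 2 * c⁻¹) * (α * ‖xdag‖ ^ 2 + C₁ * (C + 1) * δ⁻¹ * σ ^ 2 / D.n) =
        (C + 1) * c * ‖xdag‖ ^ 2 + (C + 1) ^ 2 * C₁ * σ ^ 2 / (D.n * (c * δ)) := by
      rw [← hcα]
      field_simp
    rw [e]
    have e1 : C + 1 ≤ C + 1 + (C + 1) ^ 2 * C₁ := le_add_of_nonneg_right (by positivity)
    have e2 : (C + 1) ^ 2 * C₁ ≤ C + 1 + (C + 1) ^ 2 * C₁ := le_add_of_nonneg_left (by positivity)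
    generalize C + 1 + (C + 1) ^ 2 * C₁ = A at e1 e2 ⊢
    gcongr

end NoisySampling

end WeakTikhonov

/-! ### The main theorem. -/

theorem mainTheorem3 (a b : ℝ) (hab : a < b) (m : ℕ) (hm : 0 < m) (B : ℝ)
    (k : ℝ → ℝ → ℝ) (hk : SquareIntegrableKernel a b k)
    (K : L2 a b →L[ℝ] L2 a b) (hK : K = integralOperator a b k hk)
    (hrange : ∀ x, MemSobolev a b m (K x)) :
    -- a singular system of `K` exists, and the regularized solutions are well defined
    (∃ ι : Type, Nonempty (SingularSystem K ι)) ∧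
    (∀ (σ : ℝ) (D : NoisySampling a b B σ) (α : ℝ), D.h ^ (2 * m) ≤ α →
      ∀ w : Fin D.n → ℝ, ∃! x, IsTikhonovMinimizer K D.pts w α x) ∧
    -- the formula for the dual norm
    (∀ (ι : Type*) (S : SingularSystem K ι), ∀ u ∈ K.kerᗮ,
      HasSum (fun j => S.s j * inner ℝ u (S.φ j) ^ 2) (S.normWDual u ^ 2)) ∧
    -- the error bound
    (∃ C : ℝ, 0 < C ∧
      ∀ (ι : Type*) (S : SingularSystem K ι) (y xdag : L2 a b),
        y ∈ Set.range K → IsBestApproxSolution K y xdag →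
        ∀ (σ : ℝ) (D : NoisySampling a b B σ) (α : ℝ), D.h ^ (2 * m) ≤ α →
          (∀ ω, D.solution K y α ω - xdag ∈ K.kerᗮ) ∧
          Integrable (fun ω => S.normWDual (D.solution K y α ω - xdag) ^ 2) D.P ∧
          ∫ ω, S.normWDual (D.solution K y α ω - xdag) ^ 2 ∂D.P ≤
            C * α ^ (1 / 2 : ℝ) * ‖xdag‖ ^ 2 +
              C * σ ^ 2 / (D.n * α ^ (1 / 2 + 1 / (2 * m) : ℝ))) ∧
    -- convergence in expectation
    (∀ (ι : Type*) (S : SingularSystem K ι) (y xdag : L2 a b),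
      y ∈ Set.range K → IsBestApproxSolution K y xdag →
      ∀ (σ : ℝ) (D : ℕ → NoisySampling a b B σ) (α : ℕ → ℝ),
        (∀ i, (D i).h ^ (2 * m) ≤ α i) →
        Tendsto α atTop (𝓝 0) →
        Tendsto (fun i => (D i).n * α i ^ (1 / 2 + 1 / (2 * m) : ℝ)) atTop atTop →
        Tendsto (fun i => ∫ ω, S.normWDual ((D i).solution K y (α i) ω - xdag) ^ 2 ∂(D i).P)
          atTop (𝓝 0)) := by
  have hK' := isCompactOperator_of_range hab hm hrange
  refine ⟨exists_singularSystem hK', ?_, fun ι S u hu => S.hasSum_normWDual_sq hu,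
    NoisySampling.exists_error_bound hab hm hrange B, ?_⟩
  · intro σ D α hα w
    obtain ⟨t, ht⟩ := D.exists_functionals hab hm hrange
    exact existsUnique_isTikhonovMinimizer ht (D.alpha_pos hab hα) w
  · intro ι S y xdag hy hx σ D α hα hα0 hnα
    obtain ⟨C, -, H⟩ := NoisySampling.exists_error_bound hab hm hrange B
    refine squeeze_zero (fun i => integral_nonneg fun ω => sq_nonneg _)
      (fun i => (H ι S y xdag hy hx σ (D i) (α i) (hα i)).2.2) ?_
    have h1 : Tendsto (fun i => C * α i ^ (1 / 2 : ℝ) * ‖xdag‖ ^ 2) atTop (𝓝 0) := by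
      have h := hα0.rpow_const (p := 1 / 2) (Or.inr (by norm_num))
      rw [Real.zero_rpow (by norm_num)] at h
      simpa using (h.const_mul C).mul_const (‖xdag‖ ^ 2)
    simpa using h1.add (hnα.const_div_atTop (C * σ ^ 2))
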